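/- Let $n\ge 2$, let $\Sigma\subset\mathbb R^n$ be a smooth, closed (i.e. compact, connected, without boundary), embedded hypersurface, and let $\Omega$ be the bounded domain enclosed by $\Sigma$, so that $\partial\Omega=\Sigma$. Let $\nu$ be the outward unit normal of $\Sigma$, let $\mathrm{II}(X,Y)=\langle D_X\nu,Y\rangle$ be its second fundamental form with respect to $\nu$, and let $H=\operatorname{tr}\mathrm{II}$ be its mean curvature (the sum of the principal curvatures). Assume that $\Sigma$ is convex, i.e. that $\mathrm{II}$ is positive semidefinite at every point of $\Sigma$. Let $O\in\mathbb R^n$ be any fixed point and let $r(x)=|x-O|$. Then $$ n\,\mathrm{Vol}(\Omega)\;\le\;\frac1{n-1}\int_\Sigma r^2 H\,d\mu , $$ where $d\mu$ is the $(n-1)$-dimensional surface measure on $\Sigma$. Moreover, equality holds if and only if $\Sigma$ is a sphere centered at $O$. -/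

import Mathlib

open MeasureTheory Set Filter Topology
open scoped ContDiff InnerProductSpace

noncomputable section

/-- `S` is a smooth embedded hypersurface of `E`: near each of its points it is the zero set of a
smooth function with nowhere vanishing differential. -/
def IsSmoothHypersurface {E : Type*} [NormedAddCommGroup E] [InnerProductSpace ℝ E]
    (S : Set E) : Prop :=
  ∀ p ∈ S, ∃ (U : Set E) (f : E → ℝ), IsOpen U ∧ p ∈ U ∧ ContDiffOn ℝ ∞ f U ∧
    (∀ x ∈ U, fderiv ℝ f x ≠ 0) ∧ S ∩ U = {x ∈ U | f x = 0}

/-- `Ω` is a region enclosed by `S`: a bounded domain whose boundary is `S`. -/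
structure IsRegionEnclosedBy {E : Type*} [NormedAddCommGroup E] (Ω S : Set E) : Prop where
  isOpen : IsOpen Ω
  isConnected : IsConnected Ω
  isBounded : Bornology.IsBounded Ω
  frontier_eq : frontier Ω = S

/-- The tangent space of `S` at `p`: the linear span of the tangent directions of `S` at `p`
(limits of rescaled secants). -/
def tangentSpaceAt {E : Type*} [NormedAddCommGroup E] [InnerProductSpace ℝ E]
    (S : Set E) (p : E) : Submodule ℝ E :=
  Submodule.span ℝ (tangentConeAt ℝ S p)

/-- `v` is a unit vector normal to `S` at `p` and pointing out of `Ω`. -/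
def IsOutwardUnitNormalAt {E : Type*} [NormedAddCommGroup E] [InnerProductSpace ℝ E]
    (Ω S : Set E) (p v : E) : Prop :=
  ‖v‖ = 1 ∧ v ∈ (tangentSpaceAt S p)ᗮ ∧
    ∀ᶠ t : ℝ in 𝓝[>] 0, p - t • v ∈ Ω ∧ p + t • v ∉ closure Ω

open Classical in
/-- The outward unit normal field `ν` of the boundary `S` of `Ω` (and `0` where there is none). -/
def outwardNormal {E : Type*} [NormedAddCommGroup E] [InnerProductSpace ℝ E]
    (Ω S : Set E) (p : E) : E :=
  if h : ∃ v, IsOutwardUnitNormalAt Ω S p v then h.choose else 0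

/-- The second fundamental form of `S` at `p` with respect to the outward unit normal `ν`,
`II(X, Y) = ⟪D_X ν, Y⟫` for tangent vectors `X`, `Y`. The derivative of `ν` is taken along `S`;
its values on vectors tangent to `S` do not depend on any extension of `ν` off `S`. -/
def secondFundamentalForm {E : Type*} [NormedAddCommGroup E] [InnerProductSpace ℝ E]
    (Ω S : Set E) (p : E) (X Y : tangentSpaceAt S p) : ℝ :=
  ⟪fderivWithin ℝ (outwardNormal Ω S) S p (X : E), (Y : E)⟫_ℝ

/-- The mean curvature `H` of `S` at `p`: the trace of the second fundamental form (the sum of the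
principal curvatures), computed in an orthonormal basis of the tangent space. -/
def meanCurvature {E : Type*} [NormedAddCommGroup E] [InnerProductSpace ℝ E]
    [FiniteDimensional ℝ E] (Ω S : Set E) (p : E) : ℝ :=
  ∑ i, secondFundamentalForm Ω S p
    (stdOrthonormalBasis ℝ (tangentSpaceAt S p) i) (stdOrthonormalBasis ℝ (tangentSpaceAt S p) i)

/-- `S` is a convex hypersurface: its second fundamental form with respect to the outward unit
normal is nonnegative at every point. -/
def IsConvexHypersurface {E : Type*} [NormedAddCommGroup E] [InnerProductSpace ℝ E]
    (Ω S : Set E) : Prop :=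
  ∀ p ∈ S, ∀ X : tangentSpaceAt S p, 0 ≤ secondFundamentalForm Ω S p X X

end

/-! ### Comparing measures locally, with constants tending to one -/

section LocalComparison

open scoped NNReal ENNReal

variable {X : Type*} [TopologicalSpace X] [SecondCountableTopology X] [MeasurableSpace X]
  [OpensMeasurableSpace X]

/-! Write X = x - O, u = ⟪X, ν⟫ and T = X - uν, the tangential part of X. Everything rests on the
identity ∫ r²H = (n - 1) n Vol(Ω) + ∫ (|T|²H + II(T, T)) over Σ, which is
`setIntegral_norm_sq_mul_eq`. Indeed r² = |T|² + u², the tangential field uT has divergence (n - 1)u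
- u²H + II(T, T), whose integral over the closed hypersurface vanishes, and ∫ u = n Vol(Ω) by Gauss'
theorem. Convexity makes the last integrand, `defect`, nonnegative, and the inequality follows.

In the equality case the defect vanishes on Σ by continuity, so II(T, T) = 0. Semidefiniteness
improves this to II(T, ·) = 0, which is the tangential derivative of u, so u is constant. At the
point of Σ farthest from O one has T = 0, hence max r² = u² ≤ |T|² + u² = r² everywhere: r is
constant. A bounded domain whose boundary lies in a sphere is the ball, so Σ is the whole sphere.
Conversely T = 0 on a sphere centered at O.

The analytic part is Gauss' theorem for Hausdorff measure on Σ. It is proved in cylinders where Σ is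
a graph, from the area formula, Fubini and the fundamental theorem of calculus, and globalized by a
partition of unity. The unit normal is extended to a smooth field N on the whole space, so that only
ordinary derivatives occur. The divergence theorem on Σ itself then comes from Gauss' theorem in Ω:
second derivatives commute, so ∫ (∂_w k ⟪N, v⟫ - ∂_v k ⟪N, w⟫) = 0 over Σ. This is summed over the
components of the bivector field u X ∧ N. -/

/-- An inequality between measures can be checked locally. -/
theorem MeasureTheory.Measure.le_of_locally_le {μ ν : Measure X}
    (h : ∀ x, ∃ V ∈ 𝓝 x, ∀ D ⊆ V, MeasurableSet D → μ D ≤ ν D) : μ ≤ ν := by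
  have h' : ∀ x, ∃ V ∈ 𝓝 x, MeasurableSet V ∧ ∀ D ⊆ V, MeasurableSet D → μ D ≤ ν D := by
    intro x
    obtain ⟨V, hV, hD⟩ := h x
    exact ⟨interior V, interior_mem_nhds.2 hV, isOpen_interior.measurableSet,
      fun D hDV => hD D (hDV.trans interior_subset)⟩
  choose V hV hVm hD using h'
  obtain ⟨t, htc, ht⟩ := TopologicalSpace.countable_cover_nhds hV
  refine Measure.le_iff.2 fun s hs => ?_
  rcases t.eq_empty_or_nonempty with rfl | htn
  · have : s = ∅ := by
      have : (univ : Set X) = ∅ := by simpa using ht.symm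
      exact Set.eq_empty_of_subset_empty (this ▸ subset_univ s)
    simp [this]
  obtain ⟨x, rfl⟩ := htc.exists_eq_range htn
  have hcov : (⋃ n, disjointed (fun n => V (x n)) n) = univ := by
    rw [iUnion_disjointed, ← ht]; simp
  have hm : ∀ n, MeasurableSet (s ∩ disjointed (fun n => V (x n)) n) := fun n =>
    hs.inter (MeasurableSet.disjointed (fun n => hVm (x n)) n)
  have hdis : Pairwise (Function.onFun Disjoint fun n => s ∩ disjointed (fun n => V (x n)) n) :=
    fun i j hij => (disjoint_disjointed _ hij).mono inter_subset_right inter_subset_right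
  have hs' : s = ⋃ n, s ∩ disjointed (fun n => V (x n)) n := by
    rw [← inter_iUnion, hcov, inter_univ]
  rw [hs', measure_iUnion hdis hm, measure_iUnion hdis hm]
  exact ENNReal.tsum_le_tsum fun n =>
    hD (x n) _ (inter_subset_right.trans (disjointed_subset _ n)) (hm n)

/-- Two measures that are locally comparable with constants arbitrarily close to one agree. -/
theorem MeasureTheory.Measure.eq_of_locally_comparable {μ ν : Measure X} (k : ℕ)
    (h : ∀ x, ∀ M : ℝ≥0, 1 < M → ∃ V ∈ 𝓝 x, ∀ D ⊆ V, MeasurableSet D →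
      μ D ≤ (M : ℝ≥0∞) ^ k * ν D ∧ ν D ≤ (M : ℝ≥0∞) ^ k * μ D) : μ = ν := by
  have key : ∀ a b : ℝ≥0∞, (∀ M : ℝ≥0, 1 < M → a ≤ (M : ℝ≥0∞) ^ k * b) → a ≤ b := by
    intro a b hab
    have h1 : Tendsto (fun M : ℝ≥0 => (M : ℝ≥0∞) ^ k * b) (𝓝[>] 1) (𝓝 (1 * b)) := by
      refine ENNReal.Tendsto.mul_const ?_ (Or.inl one_ne_zero)
      have : Tendsto (fun M : ℝ≥0 => (((M ^ k : ℝ≥0)) : ℝ≥0∞)) (𝓝[>] 1)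
          (𝓝 (((1 : ℝ≥0) ^ k : ℝ≥0) : ℝ≥0∞)) :=
        ENNReal.tendsto_coe.2 (((continuous_pow k).tendsto 1).mono_left nhdsWithin_le_nhds)
      simpa using this
    rw [one_mul] at h1
    exact ge_of_tendsto h1 (eventually_mem_nhdsWithin.mono fun M hM => hab M hM)
  refine le_antisymm (Measure.le_iff.2 fun s hs => key _ _ fun M hM => ?_)
    (Measure.le_iff.2 fun s hs => key _ _ fun M hM => ?_)
  · have : μ ≤ ((M : ℝ≥0∞) ^ k) • ν := by
      refine Measure.le_of_locally_le fun x => ?_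
      obtain ⟨V, hV, hD⟩ := h x M hM
      exact ⟨V, hV, fun D hDV hDm => (hD D hDV hDm).1⟩
    exact this s
  · have : ν ≤ ((M : ℝ≥0∞) ^ k) • μ := by
      refine Measure.le_of_locally_le fun x => ?_
      obtain ⟨V, hV, hD⟩ := h x M hM
      exact ⟨V, hV, fun D hDV hDm => (hD D hDV hDm).2⟩
    exact this s

end LocalComparison

/-! ### Area formula for injective immersions -/

section AreaFormula

open scoped NNReal ENNReal
open Module

/-- The map b x ↦ a x is well defined on `b '' D`, even if b is not injective, because the bound
forces a to be constant on the fibres of b; it is M-Lipschitz. -/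
theorem MeasureTheory.euclideanHausdorffMeasure_image_le_of_dist_le {α X Y : Type*}
    [MetricSpace X] [MeasurableSpace X] [BorelSpace X]
    [MetricSpace Y] [MeasurableSpace Y] [BorelSpace Y]
    {a : α → X} {b : α → Y} {D : Set α} {M : ℝ≥0}
    (h : ∀ x ∈ D, ∀ y ∈ D, dist (a x) (a y) ≤ M * dist (b x) (b y)) (d : ℕ) :
    μHE[d] (a '' D) ≤ (M : ℝ≥0∞) ^ d * μHE[d] (b '' D) := by
  rcases D.eq_empty_or_nonempty with rfl | ⟨x₀, hx₀⟩
  · simp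
  have : Nonempty α := ⟨x₀⟩
  set F : Y → X := fun z => a (Function.invFunOn b D z) with hF
  have hinv : ∀ z ∈ b '' D, Function.invFunOn b D z ∈ D ∧ b (Function.invFunOn b D z) = z :=
    fun z hz => ⟨Function.invFunOn_mem hz, Function.invFunOn_eq hz⟩
  have hFl : LipschitzOnWith M F (b '' D) := by
    refine LipschitzOnWith.of_dist_le_mul fun z hz w hw => ?_
    obtain ⟨h1, h2⟩ := hinv z hz
    obtain ⟨h3, h4⟩ := hinv w hw
    have := h _ h1 _ h3
    rwa [h2, h4] at this
  have hsub : a '' D ⊆ F '' (b '' D) := by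
    rintro _ ⟨x, hx, rfl⟩
    refine ⟨b x, ⟨x, hx, rfl⟩, ?_⟩
    obtain ⟨h1, h2⟩ := hinv (b x) ⟨x, hx, rfl⟩
    have := h _ h1 _ hx
    rw [h2, dist_self, mul_zero] at this
    exact dist_le_zero.1 this
  have h1 := hFl.hausdorffMeasure_image_le (d := (d : ℝ)) (by positivity)
  rw [ENNReal.rpow_natCast] at h1
  rw [Measure.euclideanHausdorffMeasure_def, Measure.euclideanHausdorffMeasure_def,
    Measure.smul_apply, Measure.smul_apply, ENNReal.smul_def, ENNReal.smul_def, smul_eq_mul,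
    smul_eq_mul, mul_left_comm]
  gcongr
  exact (measure_mono hsub).trans h1

variable {K E : Type*} [NormedAddCommGroup K] [InnerProductSpace ℝ K] [FiniteDimensional ℝ K]
  [NormedAddCommGroup E] [InnerProductSpace ℝ E]

theorem HasStrictFDerivAt.exists_nhds_dist_comparable {φ : K → E} {L : K →L[ℝ] E} {y₀ : K}
    (h : HasStrictFDerivAt φ L y₀) (hL : Function.Injective L) {M : ℝ≥0} (hM : 1 < M) :
    ∃ V ∈ 𝓝 y₀, ∀ y ∈ V, ∀ z ∈ V,
      dist (φ y) (φ z) ≤ M * dist (L y) (L z) ∧ dist (L y) (L z) ≤ M * dist (φ y) (φ z) := by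
  obtain ⟨κ, hκ, hanti⟩ :=
    (L : K →ₗ[ℝ] E).exists_antilipschitzWith (LinearMap.ker_eq_bot.2 hL)
  have hM' : (1 : ℝ) < M := by exact_mod_cast hM
  have hκ' : (0 : ℝ) < κ := by exact_mod_cast hκ
  -- With this linearization error, ‖φ y - φ z‖ lies between 1/M and 2 - 1/M times ‖L y - L z‖, and
  -- 2 - 1/M ≤ M because (M - 1)² ≥ 0.
  have hc : (0 : ℝ) < (1 - 1 / M) / κ := by
    apply div_pos _ hκ'
    rw [sub_pos, div_lt_one (by linarith)]; exact hM'
  obtain ⟨V, hV, hap⟩ := h.approximates_deriv_on_nhds (c := ⟨_, hc.le⟩) (Or.inr hc)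
  refine ⟨V, hV, fun y hy z hz => ?_⟩
  have h1 := hap y hy z hz
  have h2 : ‖y - z‖ ≤ κ * ‖L y - L z‖ := by
    simpa [dist_eq_norm] using hanti.le_mul_dist y z
  rw [map_sub] at h1
  have h3 : ‖φ y - φ z - (L y - L z)‖ ≤ (1 - 1 / M) * ‖L y - L z‖ := by
    calc _ ≤ (1 - 1 / M) / κ * ‖y - z‖ := h1
      _ ≤ (1 - 1 / M) / κ * (κ * ‖L y - L z‖) := by gcongr
      _ = _ := by field_simp
  set A := ‖φ y - φ z‖
  set B := ‖L y - L z‖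
  have hB : 0 ≤ B := norm_nonneg _
  have h4 : A ≤ B + (1 - 1 / M) * B := by
    have : A ≤ B + ‖φ y - φ z - (L y - L z)‖ := by
      have := norm_add_le (L y - L z) (φ y - φ z - (L y - L z)); simpa using this
    linarith
  have h5 : B ≤ A + (1 - 1 / M) * B := by
    have : B ≤ A + ‖φ y - φ z - (L y - L z)‖ := by
      have := norm_sub_le (φ y - φ z) (φ y - φ z - (L y - L z)); simpa using this
    linarith
  rw [dist_eq_norm, dist_eq_norm]
  have h6 : (2 : ℝ) - 1 / M ≤ M := by
    have : (0 : ℝ) < M := by linarith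
    rw [sub_le_iff_le_add, ← sub_le_iff_le_add', le_div_iff₀ this]
    nlinarith [sq_nonneg ((M : ℝ) - 1)]
  constructor
  · calc A ≤ (2 - 1 / M) * B := by linarith
      _ ≤ M * B := by gcongr
  · have h7 : 1 / (M : ℝ) * B ≤ A := by linarith
    have h8 : (0 : ℝ) < M := by linarith
    rw [one_div, inv_mul_le_iff₀ h8] at h7
    exact h7

variable [MeasurableSpace K] [BorelSpace K] [MeasurableSpace E] [BorelSpace E]

/-- Area formula for an injective immersion: the comparison of measures on the domain. -/
theorem comap_euclideanHausdorffMeasure_eq {φ : K → E} {L : K → K →L[ℝ] E} {B : Set K}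
    (hB : IsOpen B) (hφ : ∀ y ∈ B, HasStrictFDerivAt φ (L y) y) (hinj : InjOn φ B)
    (hL : ∀ y ∈ B, Function.Injective (L y))
    (hJ : ContinuousOn (fun y => (L y : K →ₗ[ℝ] E).normDet) B)
    (J : K → ℝ≥0) (hJm : Measurable J) (hJe : ∀ y ∈ B, (J y : ℝ) = (L y : K →ₗ[ℝ] E).normDet) :
    Measure.comap (B.domRestrict φ) μHE[finrank ℝ K] =
      Measure.comap Subtype.val ((volume : Measure K).withDensity fun y => (J y : ℝ≥0∞)) := by
  have hcont : ContinuousOn φ B := fun y hy => (hφ y hy).hasFDerivAt.continuousAt.continuousWithinAt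
  have hemb : MeasurableEmbedding (B.domRestrict φ) :=
    hcont.measurableEmbedding hB.measurableSet hinj
  have hembs : MeasurableEmbedding (Subtype.val : B → K) := .subtype_coe hB.measurableSet
  -- The distortion of lengths when φ is replaced by its differential at y₀ costs `finrank ℝ K`
  -- factors M; the oscillation of the Jacobian costs the extra one.
  refine Measure.eq_of_locally_comparable (finrank ℝ K + 1) fun y₀ M hM => ?_
  have hy₀ := y₀.2
  obtain ⟨V, hV, hVd⟩ := (hφ y₀ hy₀).exists_nhds_dist_comparable (hL y₀ hy₀) hM
  have hJ0 : 0 < J y₀ := by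
    have : (J y₀ : ℝ) ≠ 0 := by
      rw [hJe y₀ hy₀, ((L y₀ : K →ₗ[ℝ] E).normDet_ne_zero_tfae.out 0 4 :)]
      exact hL y₀ hy₀
    exact pos_iff_ne_zero.2 (by exact_mod_cast this)
  have hJc : ContinuousAt J y₀ := by
    have h1 : ContinuousAt (fun y => (J y : ℝ)) y₀ := by
      refine (hJ.continuousAt (hB.mem_nhds hy₀)).congr ?_
      filter_upwards [hB.mem_nhds hy₀] with y hy using (hJe y hy).symm
    exact NNReal.tendsto_coe.1 h1
  have hlt : J y₀ < M * J y₀ := by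
    conv_lhs => rw [← one_mul (J y₀)]
    exact mul_lt_mul_of_pos_right hM hJ0
  have hW : ∀ᶠ y in 𝓝 (y₀ : K), y ∈ V ∧ J y ≤ M * J y₀ ∧ J y₀ ≤ M * J y := by
    refine Filter.Eventually.and hV (.and ?_ ?_)
    · exact (hJc.eventually (eventually_lt_nhds hlt)).mono fun y hy => hy.le
    · have : ContinuousAt (fun y => M * J y) y₀ := continuousAt_const.mul hJc
      exact (this.eventually (eventually_gt_nhds hlt)).mono fun y hy => hy.le
  refine ⟨Subtype.val ⁻¹' {y | y ∈ V ∧ J y ≤ M * J y₀ ∧ J y₀ ≤ M * J y},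
    continuous_subtype_val.continuousAt hW, fun D hDV hDm => ?_⟩
  have hDm' : MeasurableSet (Subtype.val '' D : Set K) := hembs.measurableSet_image' hDm
  rw [hemb.comap_apply, hembs.comap_apply, withDensity_apply _ hDm']
  have himg : B.domRestrict φ '' D = φ '' (Subtype.val '' D) := by
    rw [image_image]; rfl
  rw [himg]
  set D' : Set K := Subtype.val '' D
  have hD' : ∀ y ∈ D', y ∈ V ∧ J y ≤ M * J y₀ ∧ J y₀ ≤ M * J y := by
    rintro _ ⟨y, hy, rfl⟩; exact hDV hy
  have hLvol : μHE[finrank ℝ K] (L y₀ '' D') = J y₀ * volume D' := by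
    have := (L y₀ : K →ₗ[ℝ] E).euclideanHausdorffMeasure_image_eq_normDet_mul_volume D'
    rw [← hJe y₀ hy₀, ENNReal.ofReal_coe_nnreal] at this
    exact this
  have c1 : μHE[finrank ℝ K] (φ '' D') ≤
      (M : ℝ≥0∞) ^ finrank ℝ K * μHE[finrank ℝ K] (L y₀ '' D') :=
    euclideanHausdorffMeasure_image_le_of_dist_le
      (fun x hx y hy => (hVd x (hD' x hx).1 y (hD' y hy).1).1) _
  have c2 : μHE[finrank ℝ K] (L y₀ '' D') ≤
      (M : ℝ≥0∞) ^ finrank ℝ K * μHE[finrank ℝ K] (φ '' D') :=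
    euclideanHausdorffMeasure_image_le_of_dist_le
      (fun x hx y hy => (hVd x (hD' x hx).1 y (hD' y hy).1).2) _
  have c3 : (J y₀ : ℝ≥0∞) * volume D' ≤ M * ∫⁻ y in D', J y := by
    rw [← lintegral_const_mul _ (by fun_prop), ← setLIntegral_const]
    refine setLIntegral_mono' hDm' fun y hy => ?_
    exact_mod_cast (hD' y hy).2.2
  have c4 : ∫⁻ y in D', J y ≤ (M : ℝ≥0∞) * (J y₀ * volume D') := by
    rw [← mul_assoc, ← setLIntegral_const]
    refine setLIntegral_mono' hDm' fun y hy => ?_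
    exact_mod_cast (hD' y hy).2.1
  constructor
  · calc _ ≤ _ := c1
      _ ≤ (M : ℝ≥0∞) ^ finrank ℝ K * (M * ∫⁻ y in D', J y) := by rw [hLvol]; gcongr
      _ = _ := by ring
  · calc _ ≤ _ := c4
      _ ≤ (M : ℝ≥0∞) * ((M : ℝ≥0∞) ^ finrank ℝ K * μHE[finrank ℝ K] (φ '' D')) := by
        rw [← hLvol]; gcongr
      _ = _ := by ring

/-- Area formula for an injective immersion, integrals of real functions. -/
theorem setIntegral_image_euclideanHausdorffMeasure {φ : K → E} {L : K → K →L[ℝ] E} {B : Set K}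
    (hB : IsOpen B) (hφ : ∀ y ∈ B, HasStrictFDerivAt φ (L y) y) (hinj : InjOn φ B)
    (hL : ∀ y ∈ B, Function.Injective (L y))
    (hJ : ContinuousOn (fun y => (L y : K →ₗ[ℝ] E).normDet) B) (F : E → ℝ) :
    ∫ x in φ '' B, F x ∂μHE[finrank ℝ K] =
      ∫ y in B, (L y : K →ₗ[ℝ] E).normDet * F (φ y) := by
  classical
  have hcont : ContinuousOn φ B := fun y hy => (hφ y hy).hasFDerivAt.continuousAt.continuousWithinAt
  have hemb : MeasurableEmbedding (B.domRestrict φ) :=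
    hcont.measurableEmbedding hB.measurableSet hinj
  -- The value 0 off B is immaterial; it makes the density measurable on all of K.
  set J : K → ℝ≥0 := fun y => (B.piecewise (fun y => (L y : K →ₗ[ℝ] E).normDet) 0 y).toNNReal
  have hJm : Measurable J :=
    (hJ.measurable_piecewise continuousOn_const hB.measurableSet).real_toNNReal
  have hJe : ∀ y ∈ B, (J y : ℝ) = (L y : K →ₗ[ℝ] E).normDet := fun y hy => by
    simp only [J, piecewise_eq_of_mem _ _ _ hy]
    exact Real.coe_toNNReal _ (LinearMap.normDet_nonneg _)
  have h1 := hemb.map_comap (μHE[finrank ℝ K] : Measure E)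
  rw [comap_euclideanHausdorffMeasure_eq hB hφ hinj hL hJ J hJm hJe, range_domRestrict] at h1
  rw [← h1, hemb.integral_map]
  change ∫ x : B, F (φ x) ∂_ = _
  rw [integral_subtype_comap hB.measurableSet (fun y => F (φ y)),
    setIntegral_withDensity_eq_setIntegral_toReal_smul hJm.coe_nnreal_ennreal (by simp) _
      hB.measurableSet]
  refine setIntegral_congr_fun hB.measurableSet fun y hy => ?_
  simp [hJe y hy]

/-- Area formula for an injective immersion: the measure of the image. -/
theorem euclideanHausdorffMeasure_image_eq_lintegral {φ : K → E} {L : K → K →L[ℝ] E} {B : Set K}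
    (hB : IsOpen B) (hφ : ∀ y ∈ B, HasStrictFDerivAt φ (L y) y) (hinj : InjOn φ B)
    (hL : ∀ y ∈ B, Function.Injective (L y))
    (hJ : ContinuousOn (fun y => (L y : K →ₗ[ℝ] E).normDet) B) :
    μHE[finrank ℝ K] (φ '' B) = ∫⁻ y in B, ENNReal.ofReal (L y : K →ₗ[ℝ] E).normDet := by
  classical
  have hcont : ContinuousOn φ B := fun y hy => (hφ y hy).hasFDerivAt.continuousAt.continuousWithinAt
  have hemb : MeasurableEmbedding (B.domRestrict φ) :=
    hcont.measurableEmbedding hB.measurableSet hinj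
  set J : K → ℝ≥0 := fun y => (B.piecewise (fun y => (L y : K →ₗ[ℝ] E).normDet) 0 y).toNNReal
  have hJm : Measurable J :=
    (hJ.measurable_piecewise continuousOn_const hB.measurableSet).real_toNNReal
  have hJe : ∀ y ∈ B, (J y : ℝ) = (L y : K →ₗ[ℝ] E).normDet := fun y hy => by
    simp only [J, piecewise_eq_of_mem _ _ _ hy]
    exact Real.coe_toNNReal _ (LinearMap.normDet_nonneg _)
  have h1 := congrArg (fun m => m univ) (comap_euclideanHausdorffMeasure_eq hB hφ hinj hL hJ J hJm hJe)
  have hembs : MeasurableEmbedding (Subtype.val : B → K) := .subtype_coe hB.measurableSet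
  simp only [hemb.comap_apply, hembs.comap_apply, image_univ, Subtype.range_coe,
    range_domRestrict, withDensity_apply _ hB.measurableSet] at h1
  rw [h1]
  refine setLIntegral_congr_fun hB.measurableSet fun y hy => ?_
  simp [← hJe y hy]

end AreaFormula

/-! ### Level sets as graphs over a hyperplane -/

section GraphChart

open Module

variable {E : Type*} [NormedAddCommGroup E] [InnerProductSpace ℝ E]

/-- The derivative of the graph parametrization over `eᗮ` of a level set of a function with
differential `a`. -/
noncomputable def graphDeriv (a : E →L[ℝ] ℝ) (e : E) : (ℝ ∙ e)ᗮ →L[ℝ] E :=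
  (ℝ ∙ e)ᗮ.subtypeL - ((a e)⁻¹ • a.comp (ℝ ∙ e)ᗮ.subtypeL).smulRight e

theorem graphDeriv_apply (a : E →L[ℝ] ℝ) (e : E) (y : (ℝ ∙ e)ᗮ) :
    graphDeriv a e y = (y : E) - ((a e)⁻¹ * a y) • e := by
  simp [graphDeriv]

theorem inner_orthogonal_span_singleton_left {e : E} (y : (ℝ ∙ e)ᗮ) : ⟪e, (y : E)⟫_ℝ = 0 :=
  Submodule.mem_orthogonal_singleton_iff_inner_right.1 y.2

theorem inner_orthogonal_span_singleton_right {e : E} (y : (ℝ ∙ e)ᗮ) : ⟪(y : E), e⟫_ℝ = 0 :=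
  Submodule.mem_orthogonal_singleton_iff_inner_left.1 y.2

theorem graphDeriv_injective (a : E →L[ℝ] ℝ) {e : E} (he : ‖e‖ = 1) :
    Function.Injective (graphDeriv a e) := by
  refine (injective_iff_map_eq_zero _).2 fun y hy => ?_
  rw [graphDeriv_apply, sub_eq_zero] at hy
  have h := inner_orthogonal_span_singleton_left y
  rw [hy, inner_smul_right, real_inner_self_eq_norm_sq, he] at h
  have h0 : (a e)⁻¹ * a y = 0 := by simpa using h
  rw [h0, zero_smul] at hy
  exact_mod_cast hy

theorem apply_graphDeriv {a : E →L[ℝ] ℝ} {e : E} (ha : a e ≠ 0) (y : (ℝ ∙ e)ᗮ) :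
    a (graphDeriv a e y) = 0 := by
  rw [graphDeriv_apply, map_sub, map_smul, smul_eq_mul]
  field_simp
  ring

/-- With c = ⟪G, e⟫ and w the component of G orthogonal to e, L*L is the identity plus the rank-one
map y ↦ c⁻²⟪w, y⟫w. Its determinant is 1 + |w|²/c² = |G|²/c². -/
theorem normDet_graphDeriv [FiniteDimensional ℝ E] {G e : E} (he : ‖e‖ = 1)
    (hG : 0 < ⟪G, e⟫_ℝ) :
    (graphDeriv (innerSL ℝ G) e : (ℝ ∙ e)ᗮ →ₗ[ℝ] E).normDet = ‖G‖ / ⟪G, e⟫_ℝ := by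
  set c := ⟪G, e⟫_ℝ
  set L : (ℝ ∙ e)ᗮ →ₗ[ℝ] E := (graphDeriv (innerSL ℝ G) e : (ℝ ∙ e)ᗮ →ₗ[ℝ] E)
  have hee : ⟪e, e⟫_ℝ = 1 := by rw [real_inner_self_eq_norm_sq, he]; norm_num
  have hw : G - c • e ∈ (ℝ ∙ e)ᗮ := by
    rw [Submodule.mem_orthogonal_singleton_iff_inner_left, inner_sub_left, inner_smul_left, hee]
    simp [c]
  set w : (ℝ ∙ e)ᗮ := ⟨G - c • e, hw⟩
  have hwy : ∀ y : (ℝ ∙ e)ᗮ, ⟪w, y⟫_ℝ = ⟪G, (y : E)⟫_ℝ := fun y => by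
    rw [Submodule.coe_inner]
    simp only [w]
    rw [inner_sub_left, inner_smul_left, inner_orthogonal_span_singleton_left]
    simp
  have hLL : LinearMap.adjoint L ∘ₗ L =
      LinearMap.transvection ((c ^ 2)⁻¹ • (innerₛₗ ℝ w)) w := by
    refine LinearMap.ext fun y => ext_inner_right ℝ fun z => ?_
    have hLy : ∀ y, L y = (y : E) - (c⁻¹ * ⟪G, (y : E)⟫_ℝ) • e := fun y => graphDeriv_apply _ _ y
    rw [LinearMap.comp_apply, LinearMap.adjoint_inner_left, hLy, hLy, LinearMap.transvection.apply,
      inner_add_left]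
    simp only [inner_sub_left, inner_sub_right, inner_smul_left, inner_smul_right,
      inner_orthogonal_span_singleton_left, inner_orthogonal_span_singleton_right, hee,
      Submodule.coe_inner, LinearMap.smul_apply, innerₛₗ_apply_apply, hwy]
    simp
    ring
  have h1 := L.normDet_sq
  rw [hLL, LinearMap.transvection.det] at h1
  have hww : ⟪w, w⟫_ℝ = ‖G‖ ^ 2 - c ^ 2 := by
    rw [hwy]
    simp only [w]
    rw [inner_sub_right, inner_smul_right, real_inner_self_eq_norm_sq]; ring
  simp only [LinearMap.smul_apply, innerₛₗ_apply_apply, hww] at h1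
  have h2 : L.normDet ^ 2 = (‖G‖ / c) ^ 2 := by
    have : L.normDet ^ 2 = 1 + (c ^ 2)⁻¹ • (‖G‖ ^ 2 - c ^ 2) := by exact_mod_cast h1
    rw [this, smul_eq_mul]
    field_simp
    ring
  exact (sq_eq_sq₀ L.normDet_nonneg (by positivity)).1 h2

/-- The open cylinder with axis `e` around `p`. -/
def openCylinder (p e : E) (δ η : ℝ) : Set E :=
  {x | ‖x - p - ⟪e, x - p⟫_ℝ • e‖ < δ ∧ |⟪e, x - p⟫_ℝ| < η}

theorem isOpen_openCylinder (p e : E) (δ η : ℝ) : IsOpen (openCylinder p e δ η) :=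
  (isOpen_lt (f := fun x => ‖x - p - ⟪e, x - p⟫_ℝ • e‖) (by fun_prop) continuous_const).inter
    (isOpen_lt (f := fun x => |⟪e, x - p⟫_ℝ|) (by fun_prop) continuous_const)

theorem mem_openCylinder_self {p e : E} {δ η : ℝ} (hδ : 0 < δ) (hη : 0 < η) :
    p ∈ openCylinder p e δ η := by
  simp [openCylinder, hδ, hη]

theorem mem_openCylinder_iff {p e : E} {δ η : ℝ} (he : ‖e‖ = 1) (y : (ℝ ∙ e)ᗮ) (t : ℝ) :
    p + y + t • e ∈ openCylinder p e δ η ↔ ‖y‖ < δ ∧ |t| < η := by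
  have h1 : p + (y : E) + t • e - p = y + t • e := by abel
  have h2 : ⟪e, (y : E) + t • e⟫_ℝ = t := by
    rw [inner_add_right, inner_orthogonal_span_singleton_left, inner_smul_right,
      real_inner_self_eq_norm_sq, he]; simp
  simp [openCylinder, h1, h2]

theorem exists_eq_add_smul_orthogonal (p x : E) {e : E} (he : ‖e‖ = 1) :
    ∃ (y : (ℝ ∙ e)ᗮ) (t : ℝ), x = p + y + t • e := by
  refine ⟨⟨x - p - ⟪e, x - p⟫_ℝ • e, ?_⟩, ⟪e, x - p⟫_ℝ, ?_⟩
  swap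
  · change x = p + (x - p - ⟪e, x - p⟫_ℝ • e) + ⟪e, x - p⟫_ℝ • e
    abel
  rw [Submodule.mem_orthogonal_singleton_iff_inner_right, inner_sub_right, inner_smul_right,
    real_inner_self_eq_norm_sq, he]
  simp

theorem exists_graphDeriv_apply_eq {a : E →L[ℝ] ℝ} {e w : E} (he : ‖e‖ = 1) (ha : a e ≠ 0)
    (hw : a w = 0) : ∃ y, graphDeriv a e y = w := by
  obtain ⟨y, t, hyt⟩ := exists_eq_add_smul_orthogonal 0 w he
  rw [zero_add] at hyt
  refine ⟨y, ?_⟩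
  rw [hyt, map_add, map_smul, smul_eq_mul] at hw
  rw [graphDeriv_apply, hyt, sub_eq_add_neg, ← neg_smul]
  congr 2
  field_simp
  linarith

/-- The zero set of `f` in a cylinder with axis `e` is the graph of `g`, and `f` increases along
the axis. -/
structure IsGraphChart (f : E → ℝ) (p e : E) (δ η : ℝ) (g : (ℝ ∙ e)ᗮ → ℝ) : Prop where
  norm_eq : ‖e‖ = 1
  δ_pos : 0 < δ
  η_pos : 0 < η
  contDiffAt : ∀ x ∈ openCylinder p e δ η, ContDiffAt ℝ ∞ f x
  fderiv_pos : ∀ x ∈ openCylinder p e δ η, 0 < fderiv ℝ f x e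
  abs_lt : ∀ y ∈ Metric.ball 0 δ, |g y| < η
  neg_iff : ∀ y ∈ Metric.ball (0 : (ℝ ∙ e)ᗮ) δ, ∀ t, |t| < η → (f (p + y + t • e) < 0 ↔ t < g y)
  pos_iff : ∀ y ∈ Metric.ball (0 : (ℝ ∙ e)ᗮ) δ, ∀ t, |t| < η → (0 < f (p + y + t • e) ↔ g y < t)

/-- Near p the function is strictly increasing along every line parallel to e, so the intermediate
value theorem yields exactly one zero on each short segment. Regularity of the height g is derived
afterwards. -/
theorem exists_isGraphChart {f : E → ℝ} {p e : E} {W : Set E} (hW : W ∈ 𝓝 p) (he : ‖e‖ = 1)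
    (hcd : ∀ᶠ x in 𝓝 p, ContDiffAt ℝ ∞ f x) (hfp : f p = 0) (hfe : 0 < fderiv ℝ f p e) :
    ∃ δ η g, IsGraphChart f p e δ η g ∧ openCylinder p e δ η ⊆ W := by
  have hf := hcd.self_of_nhds
  have hfd : ContinuousAt (fun x => fderiv ℝ f x e) p :=
    ((hf.fderiv_right (m := 0) (by simp)).continuousAt).clm_apply continuousAt_const
  have hall : ∀ᶠ x in 𝓝 p, x ∈ W ∧ ContDiffAt ℝ ∞ f x ∧ 0 < fderiv ℝ f x e :=
    (Filter.Eventually.and hW (hcd.and (hfd.eventually (eventually_gt_nhds hfe))))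
  obtain ⟨r, hr, hball⟩ := Metric.eventually_nhds_iff_ball.1 hall
  have hline : ∀ (y : (ℝ ∙ e)ᗮ) (t : ℝ), ‖y‖ < r / 2 → |t| < r / 2 →
      p + y + t • e ∈ Metric.ball p r := by
    intro y t hy ht
    rw [Metric.mem_ball, dist_eq_norm]
    have h1 : p + (y : E) + t • e - p = y + t • e := by abel
    rw [h1]
    calc ‖(y : E) + t • e‖ ≤ ‖(y : E)‖ + ‖t • e‖ := norm_add_le _ _
      _ = ‖y‖ + |t| := by rw [norm_smul, he]; simp
      _ < r := by linarith
  have hderiv : ∀ (y : (ℝ ∙ e)ᗮ) (t : ℝ), ‖y‖ < r / 2 → |t| < r / 2 →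
      HasDerivAt (fun t : ℝ => f (p + y + t • e)) (fderiv ℝ f (p + y + t • e) e) t := by
    intro y t hy ht
    have h1 : HasFDerivAt f (fderiv ℝ f (p + y + t • e)) (p + y + t • e) :=
      ((hball _ (hline y t hy ht)).2.1.differentiableAt (by simp)).hasFDerivAt
    have h2 : HasDerivAt (fun t : ℝ => p + (y : E) + t • e) e t := by
      simpa using ((hasDerivAt_id t).smul_const e).const_add (p + (y : E))
    exact h1.comp_hasDerivAt t h2
  have hmono : ∀ y : (ℝ ∙ e)ᗮ, ‖y‖ < r / 2 →
      StrictMonoOn (fun t : ℝ => f (p + y + t • e)) (Ioo (-(r / 2)) (r / 2)) := by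
    intro y hy
    refine strictMonoOn_of_deriv_pos (convex_Ioo _ _) ?_ ?_
    · intro t ht
      exact (hderiv y t hy (abs_lt.2 ht)).continuousAt.continuousWithinAt
    · intro t ht
      rw [interior_Ioo] at ht
      rw [(hderiv y t hy (abs_lt.2 ht)).deriv]
      exact (hball _ (hline y t hy (abs_lt.2 ht))).2.2
  -- Strictly below r/2, so that the endpoints ±η lie inside the open interval of monotonicity.
  set η := r / 4 with hη
  have hηpos : 0 < η := by positivity
  have hηr : η < r / 2 := by rw [hη]; linarith
  have hm0 := hmono 0 (by simpa using hr)
  have e1 : f (p + (-η) • e) < 0 := by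
    have := hm0 (a := -η) (b := 0) ⟨by linarith, by linarith⟩ ⟨by linarith, by linarith⟩ (by linarith)
    simpa [hfp] using this
  have e2 : 0 < f (p + η • e) := by
    have := hm0 (a := 0) (b := η) ⟨by linarith, by linarith⟩ ⟨by linarith, by linarith⟩ (by linarith)
    simpa [hfp] using this
  have hcy : ∀ t, |t| < r / 2 → ContinuousAt (fun y : (ℝ ∙ e)ᗮ => f (p + y + t • e)) 0 := by
    intro t ht
    have h1 : ContinuousAt f (p + ((0 : (ℝ ∙ e)ᗮ) : E) + t • e) :=
      (hball _ (hline 0 t (by simpa using hr) ht)).2.1.continuousAt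
    exact ContinuousAt.comp (f := fun y : (ℝ ∙ e)ᗮ => p + (y : E) + t • e) h1 (by fun_prop)
  have hη' : |η| < r / 2 := by rwa [abs_of_pos hηpos]
  have hη'' : |-η| < r / 2 := by rwa [abs_neg]
  have hev : ∀ᶠ y : (ℝ ∙ e)ᗮ in 𝓝 0, f (p + y + (-η) • e) < 0 ∧ 0 < f (p + y + η • e) := by
    refine .and ((hcy _ hη'').eventually (eventually_lt_nhds ?_))
      ((hcy _ hη').eventually (eventually_gt_nhds ?_))
    · simpa using e1
    · simpa using e2
  obtain ⟨δ₀, hδ₀, hδball⟩ := Metric.eventually_nhds_iff_ball.1 hev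
  set δ := min δ₀ (r / 2) with hδ
  have hδpos : 0 < δ := lt_min hδ₀ (by positivity)
  -- The condition on y sits inside the existential so that the chosen height is a total function,
  -- unconstrained off the ball.
  have hex : ∀ y : (ℝ ∙ e)ᗮ, ∃ t : ℝ, y ∈ Metric.ball 0 δ → |t| < η ∧ f (p + y + t • e) = 0 := by
    intro y
    by_cases hy : y ∈ Metric.ball 0 δ
    swap
    · exact ⟨0, fun h => absurd h hy⟩
    have hyr : ‖y‖ < r / 2 := by
      rw [mem_ball_zero_iff] at hy; exact hy.trans_le (min_le_right _ _)
    obtain ⟨h1, h2⟩ := hδball y (Metric.ball_subset_ball (min_le_left _ _) hy)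
    have hc : ContinuousOn (fun t : ℝ => f (p + y + t • e)) (Icc (-η) η) := fun t ht =>
      (hderiv y t hyr ((abs_le.2 ht).trans_lt hηr)).continuousAt.continuousWithinAt
    obtain ⟨t, ht, ht0⟩ := intermediate_value_Ioo (by linarith) hc (show (0 : ℝ) ∈ _ from ⟨h1, h2⟩)
    exact ⟨t, fun _ => ⟨abs_lt.2 ht, ht0⟩⟩
  choose g hg using hex
  have hcyl : ∀ x ∈ openCylinder p e δ η, x ∈ Metric.ball p r := by
    intro x hx
    obtain ⟨y, t, rfl⟩ := exists_eq_add_smul_orthogonal p x he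
    rw [mem_openCylinder_iff he] at hx
    exact hline y t (hx.1.trans_le (min_le_right _ _)) (hx.2.trans hηr)
  have hIoo : ∀ {t : ℝ}, |t| < η → t ∈ Ioo (-(r / 2)) (r / 2) := fun ht =>
    abs_lt.1 (ht.trans hηr)
  refine ⟨δ, η, g, ⟨he, hδpos, hηpos, fun x hx => (hball x (hcyl x hx)).2.1,
    fun x hx => (hball x (hcyl x hx)).2.2, fun y hy => (hg y hy).1, fun y hy t ht => ?_,
    fun y hy t ht => ?_⟩, fun x hx => (hball x (hcyl x hx)).1⟩
  · have hyr : ‖y‖ < r / 2 := by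
      rw [mem_ball_zero_iff] at hy; exact hy.trans_le (min_le_right _ _)
    rw [← (hg y hy).2]
    exact (hmono y hyr).lt_iff_lt (hIoo ht) (hIoo (hg y hy).1)
  · have hyr : ‖y‖ < r / 2 := by
      rw [mem_ball_zero_iff] at hy; exact hy.trans_le (min_le_right _ _)
    rw [← (hg y hy).2]
    exact (hmono y hyr).lt_iff_lt (hIoo (hg y hy).1) (hIoo ht)

namespace IsGraphChart

variable {f : E → ℝ} {p e : E} {δ η : ℝ} {g : (ℝ ∙ e)ᗮ → ℝ}

/-- The graph parametrization. -/
noncomputable def param (_h : IsGraphChart f p e δ η g) (y : (ℝ ∙ e)ᗮ) : E := p + y + g y • e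

theorem param_mem (h : IsGraphChart f p e δ η g) {y : (ℝ ∙ e)ᗮ} (hy : y ∈ Metric.ball 0 δ) :
    h.param y ∈ openCylinder p e δ η :=
  (mem_openCylinder_iff h.norm_eq _ _).2 ⟨mem_ball_zero_iff.1 hy, h.abs_lt y hy⟩

theorem eq_zero_iff (h : IsGraphChart f p e δ η g) {y : (ℝ ∙ e)ᗮ} (hy : y ∈ Metric.ball 0 δ)
    {t : ℝ} (ht : |t| < η) : f (p + y + t • e) = 0 ↔ t = g y := by
  have h1 := h.neg_iff y hy t ht
  have h2 := h.pos_iff y hy t ht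
  constructor
  · intro h0
    rw [h0] at h1 h2
    have h3 := not_lt.1 (fun h => lt_irrefl _ (h1.2 h))
    have h4 := not_lt.1 (fun h => lt_irrefl _ (h2.2 h))
    exact le_antisymm h4 h3
  · intro h0
    have h3 := not_lt.1 (fun h => (h1.1 h).ne h0)
    have h4 := not_lt.1 (fun h => (h2.1 h).ne' h0)
    exact le_antisymm h4 h3

theorem apply_param (h : IsGraphChart f p e δ η g) {y : (ℝ ∙ e)ᗮ} (hy : y ∈ Metric.ball 0 δ) :
    f (h.param y) = 0 :=
  (h.eq_zero_iff hy (h.abs_lt y hy)).2 rfl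

theorem param_zero (h : IsGraphChart f p e δ η g) (hp : f p = 0) : h.param 0 = p := by
  have h1 := (h.eq_zero_iff (Metric.mem_ball_self h.δ_pos) (t := 0) (by simpa using h.η_pos)).1
    (by simpa using hp)
  simp [param, ← h1]

theorem image_param (h : IsGraphChart f p e δ η g) :
    h.param '' Metric.ball 0 δ = {x ∈ openCylinder p e δ η | f x = 0} := by
  ext x
  constructor
  · rintro ⟨y, hy, rfl⟩
    exact ⟨h.param_mem hy, h.apply_param hy⟩
  · rintro ⟨hx, hx0⟩
    obtain ⟨y, t, rfl⟩ := exists_eq_add_smul_orthogonal p x h.norm_eq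
    rw [mem_openCylinder_iff h.norm_eq] at hx
    have hy : y ∈ Metric.ball 0 δ := mem_ball_zero_iff.2 hx.1
    exact ⟨y, hy, by rw [param, ← (h.eq_zero_iff hy hx.2).1 hx0]⟩

theorem injOn_param (h : IsGraphChart f p e δ η g) : InjOn h.param (Metric.ball 0 δ) := by
  intro y _ z _ hyz
  have h1 : ((y - z : (ℝ ∙ e)ᗮ) : E) = (g z - g y) • e := by
    have : p + (y : E) + g y • e = p + z + g z • e := hyz
    rw [Submodule.coe_sub, sub_smul]
    have h2 : (y : E) + g y • e = z + g z • e := by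
      rw [add_assoc, add_assoc] at this; exact add_left_cancel this
    rw [sub_eq_sub_iff_add_eq_add, h2, add_comm]
  have h2 : ⟪((y - z : (ℝ ∙ e)ᗮ) : E), ((y - z : (ℝ ∙ e)ᗮ) : E)⟫_ℝ = 0 := by
    nth_rw 2 [h1]
    rw [inner_smul_right, inner_orthogonal_span_singleton_right, mul_zero]
  rw [inner_self_eq_zero] at h2
  exact sub_eq_zero.1 (by exact_mod_cast h2)

/-- At a fixed height b the sign of f decides on which side of b the graph lies, and a strict sign
persists for nearby base points. -/
theorem continuousAt_height (h : IsGraphChart f p e δ η g) {y : (ℝ ∙ e)ᗮ}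
    (hy : y ∈ Metric.ball 0 δ) : ContinuousAt g y := by
  have hball : ∀ᶠ z in 𝓝 y, z ∈ Metric.ball (0 : (ℝ ∙ e)ᗮ) δ := Metric.isOpen_ball.mem_nhds hy
  have hc : ∀ t, |t| < η → ContinuousAt (fun z : (ℝ ∙ e)ᗮ => f (p + z + t • e)) y := by
    intro t ht
    have h1 : ContinuousAt f (p + (y : E) + t • e) := (h.contDiffAt _
      ((mem_openCylinder_iff h.norm_eq _ _).2 ⟨mem_ball_zero_iff.1 hy, ht⟩)).continuousAt
    exact ContinuousAt.comp (f := fun z : (ℝ ∙ e)ᗮ => p + (z : E) + t • e) h1 (by fun_prop)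
  have hgy := _root_.abs_lt.1 (h.abs_lt y hy)
  refine tendsto_order.2 ⟨fun a ha => ?_, fun a ha => ?_⟩
  · obtain ⟨b, hb1, hb2⟩ := exists_between (max_lt ha hgy.1)
    have hb : |b| < η := _root_.abs_lt.2 ⟨(le_max_right _ _).trans_lt hb1, hb2.trans hgy.2⟩
    have h2 := (hc b hb).eventually (eventually_lt_nhds ((h.neg_iff y hy b hb).2 hb2))
    filter_upwards [h2, hball] with z hz hzb
    exact (le_max_left _ _).trans_lt (hb1.trans ((h.neg_iff z hzb b hb).1 hz))
  · obtain ⟨b, hb1, hb2⟩ := exists_between (lt_min ha hgy.2)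
    have hb : |b| < η := _root_.abs_lt.2 ⟨hgy.1.trans hb1, hb2.trans_le (min_le_right _ _)⟩
    have h2 := (hc b hb).eventually (eventually_gt_nhds ((h.pos_iff y hy b hb).2 hb1))
    filter_upwards [h2, hball] with z hz hzb
    exact ((h.pos_iff z hzb b hb).1 hz).trans (hb2.trans_le (min_le_left _ _))

theorem continuousAt_param (h : IsGraphChart f p e δ η g) {y : (ℝ ∙ e)ᗮ}
    (hy : y ∈ Metric.ball 0 δ) : ContinuousAt h.param y := by
  have := h.continuousAt_height hy
  unfold param
  fun_prop

/-- Let Δ be an increment of the parametrization and a the differential of f. The linearization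
error is exactly (a e)⁻¹ a(Δ) e. Since f vanishes along the graph, strict differentiability of f
makes a(Δ) small compared with Δ. Using this first with constant 1/2 bounds Δ by a multiple of the
increment of the base point, which closes the estimate. -/
theorem hasStrictFDerivAt_param (h : IsGraphChart f p e δ η g) {y₀ : (ℝ ∙ e)ᗮ}
    (hy₀ : y₀ ∈ Metric.ball 0 δ) :
    HasStrictFDerivAt h.param (graphDeriv (fderiv ℝ f (h.param y₀)) e) y₀ := by
  set a := fderiv ℝ f (h.param y₀) with ha
  have hq := h.param_mem hy₀
  have hae : 0 < a e := h.fderiv_pos _ hq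
  have hstrict : HasStrictFDerivAt f a (h.param y₀) :=
    (h.contDiffAt _ hq).hasStrictFDerivAt (by simp)
  set L := graphDeriv a e
  have key : ∀ y z, h.param y - h.param z - L (y - z) =
      ((a e)⁻¹ * a (h.param y - h.param z)) • e := by
    intro y z
    have h1 : h.param y - h.param z = ((y - z : (ℝ ∙ e)ᗮ) : E) + (g y - g z) • e := by
      simp only [param, Submodule.coe_sub, sub_smul]; abel
    rw [h1, graphDeriv_apply, map_add, map_smul, smul_eq_mul, mul_add, add_smul]
    have : (a e)⁻¹ * ((g y - g z) * a e) = g y - g z := by field_simp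
    rw [this]; abel
  have hball : ∀ᶠ z in 𝓝 y₀, z ∈ Metric.ball (0 : (ℝ ∙ e)ᗮ) δ := Metric.isOpen_ball.mem_nhds hy₀
  have hbound : ∀ c : ℝ, 0 < c → ∀ᶠ w : (ℝ ∙ e)ᗮ × (ℝ ∙ e)ᗮ in 𝓝 (y₀, y₀),
      ‖h.param w.1 - h.param w.2 - L (w.1 - w.2)‖ ≤ c * ‖h.param w.1 - h.param w.2‖ := by
    intro c hc
    have hcont : Tendsto (fun w : (ℝ ∙ e)ᗮ × (ℝ ∙ e)ᗮ => (h.param w.1, h.param w.2)) (𝓝 (y₀, y₀))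
        (𝓝 (h.param y₀, h.param y₀)) := by
      have hc1 := h.continuousAt_param hy₀
      rw [nhds_prod_eq, nhds_prod_eq]
      exact Tendsto.prodMap hc1 hc1
    have h1 := hcont.eventually (hstrict.isLittleO.def (c := c * a e) (by positivity))
    have hb2 : ∀ᶠ w : (ℝ ∙ e)ᗮ × (ℝ ∙ e)ᗮ in 𝓝 (y₀, y₀),
        w.1 ∈ Metric.ball (0 : (ℝ ∙ e)ᗮ) δ ∧ w.2 ∈ Metric.ball (0 : (ℝ ∙ e)ᗮ) δ := by
      rw [nhds_prod_eq]; exact hball.prod_mk hball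
    filter_upwards [h1, hb2] with w hw hwb
    rw [h.apply_param hwb.1, h.apply_param hwb.2] at hw
    rw [key, norm_smul, h.norm_eq, mul_one, norm_mul, norm_inv, Real.norm_of_nonneg hae.le,
      inv_mul_le_iff₀ hae]
    simp only [sub_zero, zero_sub, norm_neg] at hw
    linarith
  have hbig : ∀ᶠ w : (ℝ ∙ e)ᗮ × (ℝ ∙ e)ᗮ in 𝓝 (y₀, y₀),
      ‖h.param w.1 - h.param w.2‖ ≤ 2 * ‖L‖ * ‖w.1 - w.2‖ := by
    filter_upwards [hbound (1 / 2) (by norm_num)] with w hw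
    have h1 : ‖h.param w.1 - h.param w.2‖ ≤
        ‖L (w.1 - w.2)‖ + ‖h.param w.1 - h.param w.2 - L (w.1 - w.2)‖ := by
      have := norm_add_le (L (w.1 - w.2)) (h.param w.1 - h.param w.2 - L (w.1 - w.2))
      simpa using this
    have h2 := L.le_opNorm (w.1 - w.2)
    linarith
  refine .of_isLittleO (Asymptotics.isLittleO_iff.2 fun c hc => ?_)
  have hd : (0 : ℝ) < 2 * ‖L‖ + 1 := by positivity
  filter_upwards [hbound (c / (2 * ‖L‖ + 1)) (by positivity), hbig] with w hw hwb
  calc _ ≤ c / (2 * ‖L‖ + 1) * ‖h.param w.1 - h.param w.2‖ := hw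
    _ ≤ c / (2 * ‖L‖ + 1) * ((2 * ‖L‖ + 1) * ‖w.1 - w.2‖) := by
      gcongr
      refine hwb.trans ?_
      gcongr
      linarith
    _ = _ := by field_simp

/-- Interpolating between the bottom height -η and the graph height exhibits the set as a continuous
image of a convex set. -/
theorem isPreconnected_neg (h : IsGraphChart f p e δ η g) :
    IsPreconnected {x ∈ openCylinder p e δ η | f x < 0} := by
  have himg : {x ∈ openCylinder p e δ η | f x < 0} =
      (fun w : (ℝ ∙ e)ᗮ × ℝ => p + w.1 + (-η + w.2 * (g w.1 + η)) • e) ''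
        (Metric.ball 0 δ ×ˢ Ioo 0 1) := by
    ext x
    constructor
    · rintro ⟨hx, hx0⟩
      obtain ⟨y, t, rfl⟩ := exists_eq_add_smul_orthogonal p x h.norm_eq
      rw [mem_openCylinder_iff h.norm_eq] at hx
      have hy : y ∈ Metric.ball 0 δ := mem_ball_zero_iff.2 hx.1
      have h1 := (h.neg_iff y hy t hx.2).1 hx0
      have h2 := _root_.abs_lt.1 hx.2
      have h3 := _root_.abs_lt.1 (h.abs_lt y hy)
      have h4 : 0 < g y + η := by linarith
      refine ⟨(y, (t + η) / (g y + η)), ⟨hy, div_pos (by linarith) h4,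
        (div_lt_one h4).2 (by linarith)⟩, ?_⟩
      simp only
      rw [div_mul_cancel₀ _ h4.ne']; congr 2; ring
    · rintro ⟨⟨y, s⟩, ⟨hy, hs⟩, rfl⟩
      have h3 := _root_.abs_lt.1 (h.abs_lt y hy)
      have h4 : 0 < g y + η := by linarith
      have h5 : -η + s * (g y + η) < g y := by nlinarith [hs.2]
      have h6 : |-η + s * (g y + η)| < η :=
        _root_.abs_lt.2 ⟨by nlinarith [mul_pos hs.1 h4], by linarith⟩
      exact ⟨(mem_openCylinder_iff h.norm_eq _ _).2 ⟨mem_ball_zero_iff.1 hy, h6⟩,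
        (h.neg_iff y hy _ h6).2 h5⟩
  rw [himg]
  refine (((convex_ball _ _).prod (convex_Ioo _ _)).isPreconnected).image _ fun w hw => ?_
  have := ContinuousAt.comp (f := Prod.fst) (x := w) (h.continuousAt_height hw.1) continuousAt_fst
  refine ContinuousAt.continuousWithinAt ?_
  have h2 : ContinuousAt (fun w : (ℝ ∙ e)ᗮ × ℝ => g w.1) w := this
  have h3 : ContinuousAt (fun w : (ℝ ∙ e)ᗮ × ℝ => (w.1 : E)) w :=
    (continuous_subtype_val.comp continuous_fst).continuousAt
  exact (continuousAt_const.add h3).add ((continuousAt_const.add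
    (continuousAt_snd.mul (h2.add continuousAt_const))).smul continuousAt_const)

theorem isPreconnected_pos (h : IsGraphChart f p e δ η g) :
    IsPreconnected {x ∈ openCylinder p e δ η | 0 < f x} := by
  have himg : {x ∈ openCylinder p e δ η | 0 < f x} =
      (fun w : (ℝ ∙ e)ᗮ × ℝ => p + w.1 + (η + w.2 * (g w.1 - η)) • e) ''
        (Metric.ball 0 δ ×ˢ Ioo 0 1) := by
    ext x
    constructor
    · rintro ⟨hx, hx0⟩
      obtain ⟨y, t, rfl⟩ := exists_eq_add_smul_orthogonal p x h.norm_eq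
      rw [mem_openCylinder_iff h.norm_eq] at hx
      have hy : y ∈ Metric.ball 0 δ := mem_ball_zero_iff.2 hx.1
      have h1 := (h.pos_iff y hy t hx.2).1 hx0
      have h2 := _root_.abs_lt.1 hx.2
      have h3 := _root_.abs_lt.1 (h.abs_lt y hy)
      have h4 : 0 < η - g y := by linarith
      refine ⟨(y, (η - t) / (η - g y)), ⟨hy, div_pos (by linarith) h4,
        (div_lt_one h4).2 (by linarith)⟩, ?_⟩
      simp only
      rw [← neg_sub η (g y), mul_neg, div_mul_cancel₀ _ h4.ne']; congr 2; ring
    · rintro ⟨⟨y, s⟩, ⟨hy, hs⟩, rfl⟩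
      have h3 := _root_.abs_lt.1 (h.abs_lt y hy)
      have h4 : 0 < η - g y := by linarith
      have h5 : g y < η + s * (g y - η) := by nlinarith [hs.2]
      have h6 : |η + s * (g y - η)| < η :=
        _root_.abs_lt.2 ⟨by linarith, by nlinarith [mul_pos hs.1 h4]⟩
      exact ⟨(mem_openCylinder_iff h.norm_eq _ _).2 ⟨mem_ball_zero_iff.1 hy, h6⟩,
        (h.pos_iff y hy _ h6).2 h5⟩
  rw [himg]
  refine (((convex_ball _ _).prod (convex_Ioo _ _)).isPreconnected).image _ fun w hw => ?_
  have := ContinuousAt.comp (f := Prod.fst) (x := w) (h.continuousAt_height hw.1) continuousAt_fst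
  refine ContinuousAt.continuousWithinAt ?_
  have h2 : ContinuousAt (fun w : (ℝ ∙ e)ᗮ × ℝ => g w.1) w := this
  have h3 : ContinuousAt (fun w : (ℝ ∙ e)ᗮ × ℝ => (w.1 : E)) w :=
    (continuous_subtype_val.comp continuous_fst).continuousAt
  exact (continuousAt_const.add h3).add ((continuousAt_const.add
    (continuousAt_snd.mul (h2.sub continuousAt_const))).smul continuousAt_const)

end IsGraphChart

end GraphChart

/-! ### The two sides of the boundary, defining functions and tangent spaces -/

section EnclosedRegion

variable {E : Type*} [NormedAddCommGroup E]

theorem IsRegionEnclosedBy.disjoint {Ω S : Set E} (hΩ : IsRegionEnclosedBy Ω S) :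
    Disjoint Ω S := by
  rw [← hΩ.frontier_eq, hΩ.isOpen.frontier_eq]
  exact disjoint_sdiff_right

theorem IsRegionEnclosedBy.closure_eq {Ω S : Set E} (hΩ : IsRegionEnclosedBy Ω S) :
    closure Ω = Ω ∪ S := by
  rw [← hΩ.frontier_eq, closure_eq_self_union_frontier]

/-- The interior Ω and the exterior are disjoint open sets that together cover the complement of S.
-/
theorem IsRegionEnclosedBy.subset_or_disjoint_closure {Ω S A : Set E}
    (hΩ : IsRegionEnclosedBy Ω S) (hA : IsPreconnected A) (hAS : Disjoint A S) :
    A ⊆ Ω ∨ A ⊆ (closure Ω)ᶜ := by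
  refine isPreconnected_iff_subset_of_disjoint.1 hA Ω (closure Ω)ᶜ hΩ.isOpen
    isClosed_closure.isOpen_compl (fun x hx => ?_) ?_
  · by_cases h : x ∈ Ω
    · exact Or.inl h
    · refine Or.inr fun hx' => ?_
      rw [hΩ.closure_eq] at hx'
      exact hx'.elim h fun h => hAS.le_bot ⟨hx, h⟩
  · ext x
    simp only [mem_inter_iff, mem_compl_iff, mem_empty_iff_false, iff_false, not_and, not_not]
    exact fun _ h => subset_closure h

variable [InnerProductSpace ℝ E]

theorem exists_norm_eq_one_apply_pos {a : E →L[ℝ] ℝ} (ha : a ≠ 0) :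
    ∃ e, ‖e‖ = 1 ∧ 0 < a e := by
  obtain ⟨v, hv⟩ : ∃ v, 0 < a v := by
    by_contra! hcon
    refine ha (ContinuousLinearMap.ext fun v => le_antisymm (hcon v) ?_)
    have := hcon (-v)
    rw [map_neg] at this
    simpa using this
  have hv0 : v ≠ 0 := by rintro rfl; simp at hv
  have hn : 0 < ‖v‖ := norm_pos_iff.2 hv0
  refine ⟨‖v‖⁻¹ • v, by rw [norm_smul, norm_inv, norm_norm, inv_mul_cancel₀ hn.ne'], ?_⟩
  rw [map_smul, smul_eq_mul]
  positivity

/-- `f` is a defining function of the boundary `S` of `Ω` on `U`, negative inside `Ω`. -/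
structure IsDefiningOn (Ω S U : Set E) (f : E → ℝ) : Prop where
  isOpen : IsOpen U
  contDiffOn : ContDiffOn ℝ ∞ f U
  fderiv_ne : ∀ x ∈ U, fderiv ℝ f x ≠ 0
  inter_eq : S ∩ U = {x ∈ U | f x = 0}
  region_inter_eq : Ω ∩ U = {x ∈ U | f x < 0}

theorem IsDefiningOn.notMem_closure {Ω S U : Set E} {f : E → ℝ} (hΩ : IsRegionEnclosedBy Ω S)
    (h : IsDefiningOn Ω S U f) {x : E} (hx : x ∈ U) (hfx : 0 < f x) : x ∉ closure Ω := by
  rw [hΩ.closure_eq]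
  rintro (hx' | hx')
  · have : x ∈ Ω ∩ U := ⟨hx', hx⟩
    rw [h.region_inter_eq] at this
    exact lt_asymm hfx this.2
  · have : x ∈ S ∩ U := ⟨hx', hx⟩
    rw [h.inter_eq] at this
    exact hfx.ne' this.2

theorem HasFDerivAt.eventually_pos_along {f : E → ℝ} {a : E →L[ℝ] ℝ} {p v : E}
    (hf : HasFDerivAt f a p) (hp : f p = 0) (hv : 0 < a v) :
    ∀ᶠ t : ℝ in 𝓝[>] 0, f (p - t • v) < 0 ∧ 0 < f (p + t • v) := by
  have h1 : HasDerivAt (fun t : ℝ => f (p + t • v)) (a v) 0 := by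
    have h2 : HasDerivAt (fun t : ℝ => p + t • v) v 0 := by
      simpa using ((hasDerivAt_id (0 : ℝ)).smul_const v).const_add p
    have h3 : HasFDerivAt f a (p + (0 : ℝ) • v) := by simpa using hf
    exact h3.comp_hasDerivAt 0 h2
  have h2 := (hasDerivAt_iff_tendsto_slope.1 h1).eventually (eventually_gt_nhds hv)
  rw [eventually_nhdsWithin_iff] at h2 ⊢
  have h3 : ∀ᶠ t : ℝ in 𝓝 0, -t ∈ ({0} : Set ℝ)ᶜ →
      0 < slope (fun t : ℝ => f (p + t • v)) 0 (-t) := by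
    have : Tendsto (fun t : ℝ => -t) (𝓝 0) (𝓝 0) := by simpa using (continuous_neg.tendsto (0 : ℝ))
    exact this.eventually h2
  filter_upwards [h2, h3] with t ht1 ht2 ht
  have ht' : (0 : ℝ) < t := ht
  have h4 := ht1 (by simpa using ht'.ne')
  have h5 := ht2 (by simpa using ht'.ne')
  simp only [slope_def_field, zero_smul, add_zero, hp, sub_zero, neg_smul, ← sub_eq_add_neg] at h4 h5
  constructor
  · by_contra hcon
    exact absurd h5 (not_lt.2 (div_nonpos_of_nonneg_of_nonpos (not_lt.1 hcon) (by linarith)))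
  · by_contra hcon
    exact absurd h4 (not_lt.2 (div_nonpos_of_nonpos_of_nonneg (not_lt.1 hcon) (by linarith)))

theorem IsDefiningOn.notMem_interior_closure {Ω S U : Set E} {f : E → ℝ}
    (hΩ : IsRegionEnclosedBy Ω S) (h : IsDefiningOn Ω S U f) {p : E} (hp : p ∈ S ∩ U) :
    p ∉ interior (closure Ω) := by
  intro hpi
  obtain ⟨e, -, he⟩ := exists_norm_eq_one_apply_pos (h.fderiv_ne p hp.2)
  have hfp : f p = 0 := by rw [h.inter_eq] at hp; exact hp.2
  have hd : HasFDerivAt f (fderiv ℝ f p) p :=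
    ((h.contDiffOn.contDiffAt (h.isOpen.mem_nhds hp.2)).differentiableAt (by simp)).hasFDerivAt
  have h1 := hd.eventually_pos_along hfp he
  have hc : Tendsto (fun t : ℝ => p + t • e) (𝓝[>] 0) (𝓝 p) := by
    have : Continuous fun t : ℝ => p + t • e := by fun_prop
    simpa using (this.tendsto 0).mono_left (nhdsWithin_le_nhds (s := Ioi 0))
  have h2 := hc.eventually ((h.isOpen.inter isOpen_interior).mem_nhds ⟨hp.2, hpi⟩)
  obtain ⟨t, ht1, ht2⟩ := (h1.and h2).exists
  exact h.notMem_closure hΩ ht2.1 ht1.2 (interior_subset ht2.2)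

/-- S cuts a small cylinder into two connected halves, each inside Ω or exterior to it. Both inside
puts p in the interior of the closure; one of each makes f or -f a defining function; both outside
is impossible for a boundary point. -/
theorem IsRegionEnclosedBy.mem_interior_or_exists_isDefiningOn {Ω S : Set E}
    (hΩ : IsRegionEnclosedBy Ω S) (hS : IsSmoothHypersurface S) {p : E} (hp : p ∈ S) :
    p ∈ interior (closure Ω) ∨ ∃ U f, p ∈ U ∧ IsDefiningOn Ω S U f := by
  obtain ⟨U, f, hU, hpU, hf, hfd, hSU⟩ := hS p hp
  obtain ⟨e, he, hae⟩ := exists_norm_eq_one_apply_pos (hfd p hpU)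
  have hfp : f p = 0 := by
    have : p ∈ S ∩ U := ⟨hp, hpU⟩
    rw [hSU] at this; exact this.2
  have hcd : ∀ᶠ x in 𝓝 p, ContDiffAt ℝ ∞ f x := by
    filter_upwards [hU.mem_nhds hpU] with x hx using hf.contDiffAt (hU.mem_nhds hx)
  obtain ⟨δ, η, g, hg, hsub⟩ := exists_isGraphChart (hU.mem_nhds hpU) he hcd hfp hae
  set C := openCylinder p e δ η
  have hpC : p ∈ C := mem_openCylinder_self hg.δ_pos hg.η_pos
  have hCo : IsOpen C := isOpen_openCylinder _ _ _ _
  have hSC : ∀ x ∈ C, (x ∈ S ↔ f x = 0) := fun x hx => by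
    have : x ∈ S ∩ U ↔ x ∈ {x ∈ U | f x = 0} := by rw [hSU]
    simpa [hsub hx] using this
  have hSC' : S ∩ C = {x ∈ C | f x = 0} := by
    ext x; exact ⟨fun h => ⟨h.2, (hSC x h.2).1 h.1⟩, fun h => ⟨(hSC x h.1).2 h.2, h.1⟩⟩
  have hl := hΩ.subset_or_disjoint_closure hg.isPreconnected_neg
    (disjoint_left.2 fun x hx hxS => hx.2.ne ((hSC x hx.1).1 hxS))
  have hu := hΩ.subset_or_disjoint_closure hg.isPreconnected_pos
    (disjoint_left.2 fun x hx hxS => hx.2.ne' ((hSC x hx.1).1 hxS))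
  rcases hl with hl | hl <;> rcases hu with hu | hu
  · left
    refine mem_interior.2 ⟨C, fun x hx => ?_, hCo, hpC⟩
    rw [hΩ.closure_eq]
    rcases lt_trichotomy (f x) 0 with h | h | h
    · exact Or.inl (hl ⟨hx, h⟩)
    · exact Or.inr ((hSC x hx).2 h)
    · exact Or.inl (hu ⟨hx, h⟩)
  · right
    refine ⟨C, f, hpC, hCo, hf.mono hsub, fun x hx => hfd x (hsub hx), hSC', ?_⟩
    ext x
    refine ⟨fun h => ⟨h.2, ?_⟩, fun h => ⟨hl h, h.1⟩⟩
    rcases lt_trichotomy (f x) 0 with h' | h' | h'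
    · exact h'
    · exact absurd ((hSC x h.2).2 h') (disjoint_left.1 hΩ.disjoint h.1)
    · exact absurd (subset_closure h.1) (hu ⟨h.2, h'⟩)
  · right
    refine ⟨C, fun x => -f x, hpC, hCo, (hf.mono hsub).neg, fun x hx => ?_, ?_, ?_⟩
    · rw [fderiv_fun_neg]; exact neg_ne_zero.2 (hfd x (hsub hx))
    · rw [hSC']; simp
    ext x
    simp only [mem_inter_iff, mem_ofPred_eq, neg_lt_zero]
    refine ⟨fun h => ⟨h.2, ?_⟩, fun h => ⟨hu h, h.1⟩⟩
    rcases lt_trichotomy (f x) 0 with h' | h' | h'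
    · exact absurd (subset_closure h.1) (hl ⟨h.2, h'⟩)
    · exact absurd ((hSC x h.2).2 h') (disjoint_left.1 hΩ.disjoint h.1)
    · exact h'
  · exfalso
    have hpc : p ∈ closure Ω := by rw [hΩ.closure_eq]; exact Or.inr hp
    obtain ⟨x, hxC, hxΩ⟩ := mem_closure_iff.1 hpc C hCo hpC
    rcases lt_trichotomy (f x) 0 with h' | h' | h'
    · exact absurd (subset_closure hxΩ) (hl ⟨hxC, h'⟩)
    · exact absurd ((hSC x hxC).2 h') (disjoint_left.1 hΩ.disjoint hxΩ)
    · exact absurd (subset_closure hxΩ) (hu ⟨hxC, h'⟩)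

/-- The boundary of an enclosed region has near each point a defining function which is negative
inside the region. -/
theorem IsRegionEnclosedBy.exists_isDefiningOn [Nontrivial E] {Ω S : Set E}
    (hΩ : IsRegionEnclosedBy Ω S) (hS : IsSmoothHypersurface S) (hconn : IsConnected S)
    {p : E} (hp : p ∈ S) : ∃ U f, p ∈ U ∧ IsDefiningOn Ω S U f := by
  set V : Set E := ⋃₀ {U | ∃ f, IsDefiningOn Ω S U f}
  have hV : IsOpen V := isOpen_sUnion fun U ⟨f, hf⟩ => hf.isOpen
  have hcov : S ⊆ interior (closure Ω) ∪ V := fun q hq => by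
    rcases hΩ.mem_interior_or_exists_isDefiningOn hS hq with h | ⟨U, f, hqU, hf⟩
    · exact Or.inl h
    · exact Or.inr ⟨U, ⟨f, hf⟩, hqU⟩
  have hdis : S ∩ (interior (closure Ω) ∩ V) = ∅ := by
    refine eq_empty_of_forall_notMem ?_
    rintro q ⟨hqS, hqi, U, ⟨f, hf⟩, hqU⟩
    exact hf.notMem_interior_closure hΩ ⟨hqS, hqU⟩ hqi
  -- Both alternatives are open and exclusive on S, so by connectedness one of them holds
  -- throughout. If Ω lay on both sides everywhere, its closure would be clopen, hence the whole
  -- space, against boundedness.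
  rcases isPreconnected_iff_subset_of_disjoint.1 hconn.isPreconnected _ _ isOpen_interior hV hcov
    hdis with h | h
  · exfalso
    have hop : IsOpen (closure Ω) := by
      rw [← interior_eq_iff_isOpen]
      refine interior_subset.antisymm ?_
      nth_rw 1 [hΩ.closure_eq]
      exact union_subset (interior_maximal subset_closure hΩ.isOpen) h
    have huniv : closure Ω = univ :=
      IsClopen.eq_univ ⟨isClosed_closure, hop⟩ hΩ.isConnected.nonempty.closure
    have hb := hΩ.isBounded.closure
    rw [huniv] at hb
    exact NormedSpace.unbounded_univ ℝ E hb
  · obtain ⟨U, ⟨f, hf⟩, hpU⟩ := h hp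
    exact ⟨U, f, hpU, hf⟩

/-- Derivatives along `S` of functions which agree on `S` agree on tangent vectors. -/
theorem HasFDerivWithinAt.apply_eq_of_mem_tangentSpaceAt {F : Type*} [NormedAddCommGroup F]
    [NormedSpace ℝ F] {S : Set E} {φ ψ : E → F} {φ' ψ' : E →L[ℝ] F} {p w : E}
    (hφ : HasFDerivWithinAt φ φ' S p) (hψ : HasFDerivWithinAt ψ ψ' S p)
    (hφψ : φ =ᶠ[𝓝[S] p] ψ) (hp : p ∈ S) (hw : w ∈ tangentSpaceAt S p) : φ' w = ψ' w := by
  have h1 : HasFDerivWithinAt φ ψ' S p := hψ.congr_of_eventuallyEq hφψ (hφψ.self_of_nhdsWithin hp)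
  have h2 : tangentSpaceAt S p ≤ (φ' - ψ').toLinearMap.ker := by
    refine Submodule.span_le.2 fun v hv => ?_
    have := hφ.unique_on h1 hv
    simpa [sub_eq_zero] using this
  have := h2 hw
  simpa [sub_eq_zero] using this

namespace IsDefiningOn

variable {Ω S U : Set E} {f : E → ℝ}

theorem contDiffAt (h : IsDefiningOn Ω S U f) {x : E} (hx : x ∈ U) : ContDiffAt ℝ ∞ f x :=
  h.contDiffOn.contDiffAt (h.isOpen.mem_nhds hx)

theorem mem_iff (h : IsDefiningOn Ω S U f) {x : E} (hx : x ∈ U) : x ∈ S ↔ f x = 0 := by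
  have : x ∈ S ∩ U ↔ x ∈ {x ∈ U | f x = 0} := by rw [h.inter_eq]
  simpa [hx] using this

theorem mem_region_iff (h : IsDefiningOn Ω S U f) {x : E} (hx : x ∈ U) : x ∈ Ω ↔ f x < 0 := by
  have : x ∈ Ω ∩ U ↔ x ∈ {x ∈ U | f x < 0} := by rw [h.region_inter_eq]
  simpa [hx] using this

theorem exists_isGraphChart (h : IsDefiningOn Ω S U f) {p e : E} (hp : p ∈ S ∩ U) (he : ‖e‖ = 1)
    (hfe : 0 < fderiv ℝ f p e) {W : Set E} (hW : W ∈ 𝓝 p) :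
    ∃ δ η g, IsGraphChart f p e δ η g ∧ openCylinder p e δ η ⊆ W ∩ U := by
  refine _root_.exists_isGraphChart (inter_mem hW (h.isOpen.mem_nhds hp.2)) he ?_
    ((h.mem_iff hp.2).1 hp.1) hfe
  filter_upwards [h.isOpen.mem_nhds hp.2] with x hx using h.contDiffAt hx

theorem image_param (h : IsDefiningOn Ω S U f) {p e : E} {δ η : ℝ} {g : (ℝ ∙ e)ᗮ → ℝ}
    (hg : IsGraphChart f p e δ η g) (hU : openCylinder p e δ η ⊆ U) :
    hg.param '' Metric.ball 0 δ = S ∩ openCylinder p e δ η := by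
  rw [hg.image_param]
  ext x
  exact ⟨fun hx => ⟨(h.mem_iff (hU hx.1)).2 hx.2, hx.1⟩,
    fun hx => ⟨hx.2, (h.mem_iff (hU hx.2)).1 hx.1⟩⟩

theorem fderiv_apply_eq_zero (h : IsDefiningOn Ω S U f) {p w : E} (hp : p ∈ S ∩ U)
    (hw : w ∈ tangentSpaceAt S p) : fderiv ℝ f p w = 0 := by
  have h1 : HasFDerivWithinAt f (fderiv ℝ f p) S p :=
    ((h.contDiffAt hp.2).differentiableAt (by simp)).hasFDerivAt.hasFDerivWithinAt
  have h2 : HasFDerivWithinAt (fun _ => (0 : ℝ)) (0 : E →L[ℝ] ℝ) S p :=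
    hasFDerivWithinAt_const _ _ _
  refine h1.apply_eq_of_mem_tangentSpaceAt h2 ?_ hp.1 hw
  filter_upwards [self_mem_nhdsWithin, mem_nhdsWithin_of_mem_nhds (h.isOpen.mem_nhds hp.2)]
    with x hxS hxU using (h.mem_iff hxU).1 hxS

/-- A vector killed by the differential of f is the velocity at p of a curve in S, the image under a
graph parametrization of a line through 0, so it lies in the tangent cone itself. -/
theorem mem_tangentSpaceAt (h : IsDefiningOn Ω S U f) {p w : E} (hp : p ∈ S ∩ U)
    (hw : fderiv ℝ f p w = 0) : w ∈ tangentSpaceAt S p := by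
  obtain ⟨e, he, hae⟩ := exists_norm_eq_one_apply_pos (h.fderiv_ne p hp.2)
  obtain ⟨δ, η, g, hg, hsub⟩ := h.exists_isGraphChart hp he hae univ_mem
  have h0 : (0 : (ℝ ∙ e)ᗮ) ∈ Metric.ball 0 δ := Metric.mem_ball_self hg.δ_pos
  have hp0 : hg.param 0 = p := hg.param_zero ((h.mem_iff hp.2).1 hp.1)
  have hd := (hg.hasStrictFDerivAt_param h0).hasFDerivAt
  obtain ⟨y, hw'⟩ := exists_graphDeriv_apply_eq he hae.ne' hw
  rw [hp0] at hd
  refine Submodule.subset_span ?_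
  have hl : HasDerivAt (fun s : ℝ => hg.param (s • y)) w 0 := by
    have h2 : HasDerivAt (fun s : ℝ => s • y) y 0 := by
      simpa using (hasDerivAt_id (0 : ℝ)).smul_const y
    have h3 : HasFDerivAt hg.param (graphDeriv (fderiv ℝ f p) e) ((0 : ℝ) • y) := by
      simpa using hd
    rw [← hw']
    exact h3.comp_hasDerivAt 0 h2
  have hsl := hasDerivAt_iff_tendsto_slope.1 hl
  refine mem_tangentConeAt_of_seq (𝓝[≠] (0 : ℝ)) (fun s => s⁻¹) (fun s => hg.param (s • y) - p)
    ?_ ?_ ?_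
  · have := hl.continuousAt.tendsto
    simp only [zero_smul, hp0] at this
    have h4 := (this.sub_const p).mono_left (nhdsWithin_le_nhds (s := {0}ᶜ))
    rwa [sub_self] at h4
  · have h5 : Tendsto (fun s : ℝ => s • y) (𝓝[≠] 0) (𝓝 0) := by
      have : Continuous fun s : ℝ => s • y := by fun_prop
      simpa using (this.tendsto 0).mono_left (nhdsWithin_le_nhds (s := {0}ᶜ))
    filter_upwards [h5.eventually (Metric.isOpen_ball.mem_nhds h0)] with s hs
    have : hg.param (s • y) ∈ S ∩ openCylinder p e δ η := by
      rw [← h.image_param hg (hsub.trans inter_subset_right)]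
      exact mem_image_of_mem _ hs
    simpa using this.1
  · refine hsl.congr fun s => ?_
    simp [slope, hp0]

end IsDefiningOn

/-- The left side is the trace of the compression of D to T. By cyclicity it equals the trace of the
projection onto T composed with D, and that projection is the identity minus ⟪ν, ·⟫ν. -/
theorem trace_orthogonal_span_singleton [FiniteDimensional ℝ E] {ν : E} (hν : ‖ν‖ = 1)
    (D : E →L[ℝ] E) {T : Submodule ℝ E} (hT : T = (ℝ ∙ ν)ᗮ) :
    ∑ i, ⟪D (stdOrthonormalBasis ℝ T i), (stdOrthonormalBasis ℝ T i : E)⟫_ℝ =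
      LinearMap.trace ℝ E D - ⟪D ν, ν⟫_ℝ := by
  set A : E →ₗ[ℝ] T := T.orthogonalProjectionOnto.toLinearMap ∘ₗ D.toLinearMap
  have h1 : ∑ i, ⟪D (stdOrthonormalBasis ℝ T i), (stdOrthonormalBasis ℝ T i : E)⟫_ℝ =
      LinearMap.trace ℝ T (A ∘ₗ T.subtype) := by
    rw [LinearMap.trace_eq_sum_inner _ (stdOrthonormalBasis ℝ T)]
    refine Finset.sum_congr rfl fun i _ => ?_
    simp only [A, LinearMap.comp_apply]
    rw [real_inner_comm]
    simp
  have h2 : T.subtype ∘ₗ A =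
      D.toLinearMap - ((innerₛₗ ℝ ν) ∘ₗ D.toLinearMap).smulRight ν := by
    ext x
    subst hT
    have := Submodule.starProjection_orthogonal_val (K := ℝ ∙ ν) (D x)
    simp only [A, LinearMap.comp_apply, LinearMap.sub_apply, LinearMap.smulRight_apply]
    rw [Submodule.starProjection_unit_singleton ℝ hν] at this
    simpa using this
  rw [h1, LinearMap.trace_comp_comm', h2, map_sub, LinearMap.trace_smulRight]
  simp [real_inner_comm]

end EnclosedRegion

/-! ### Smooth extension of the normal field and the second fundamental form -/

section NormalField

variable {E : Type*} [NormedAddCommGroup E] [InnerProductSpace ℝ E]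

/-- `N` is a smooth vector field on the whole space that extends the outward normal field of the
boundary `S` of `Ω`, where `S` has local defining functions. -/
structure IsNormalExtension (Ω S : Set E) (N : E → E) : Prop where
  region : IsRegionEnclosedBy Ω S
  isCompact : IsCompact S
  isConnected : IsConnected S
  exists_isDefiningOn : ∀ p ∈ S, ∃ U f, p ∈ U ∧ IsDefiningOn Ω S U f
  contDiff : ContDiff ℝ ∞ N
  eq_outwardNormal : ∀ p ∈ S, N p = outwardNormal Ω S p

namespace IsNormalExtension

variable {Ω S : Set E} {N : E → E}

theorem hasFDerivAt (h : IsNormalExtension Ω S N) (p : E) : HasFDerivAt N (fderiv ℝ N p) p :=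
  (h.contDiff.differentiable (by simp) p).hasFDerivAt

/-- The derivative within S is determined only on tangent vectors, and there any extension of the
normal gives the same value. -/
theorem secondFundamentalForm_eq (h : IsNormalExtension Ω S N) {p : E} (hp : p ∈ S)
    (X Y : tangentSpaceAt S p) :
    secondFundamentalForm Ω S p X Y = ⟪fderiv ℝ N p X, (Y : E)⟫_ℝ := by
  have h1 : HasFDerivWithinAt (outwardNormal Ω S) (fderiv ℝ N p) S p :=
    (h.hasFDerivAt p).hasFDerivWithinAt.congr (fun x hx => (h.eq_outwardNormal x hx).symm)
      (h.eq_outwardNormal p hp).symm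
  rw [secondFundamentalForm, h1.differentiableWithinAt.hasFDerivWithinAt.apply_eq_of_mem_tangentSpaceAt
    h1 EventuallyEq.rfl hp X.2]

/-- A chart around each point of the hypersurface. -/
theorem exists_chart (h : IsNormalExtension Ω S N) {p : E} (hp : p ∈ S) :
    ∃ U f e δ η g, IsDefiningOn Ω S U f ∧ p ∈ S ∩ U ∧
      ∃ hg : IsGraphChart f p e δ η g, hg.param '' Metric.ball 0 δ = S ∩ openCylinder p e δ η ∧
        openCylinder p e δ η ⊆ U := by
  obtain ⟨U, f, hpU, hf⟩ := h.exists_isDefiningOn p hp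
  obtain ⟨e, he, hae⟩ := exists_norm_eq_one_apply_pos (hf.fderiv_ne p hpU)
  obtain ⟨δ, η, g, hg, hsub⟩ := hf.exists_isGraphChart ⟨hp, hpU⟩ he hae univ_mem
  exact ⟨U, f, e, δ, η, g, hf, ⟨hp, hpU⟩, hg, hf.image_param hg (hsub.trans inter_subset_right),
    hsub.trans inter_subset_right⟩

/-- A differentiable function whose tangential derivative vanishes is constant on `S`. -/
theorem eq_of_fderiv_apply_eq_zero (h : IsNormalExtension Ω S N) {φ : E → ℝ}
    (hφ : Differentiable ℝ φ) (h0 : ∀ p ∈ S, ∀ w ∈ tangentSpaceAt S p, fderiv ℝ φ p w = 0)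
    {p q : E} (hp : p ∈ S) (hq : q ∈ S) : φ p = φ q := by
  have : PreconnectedSpace S := isPreconnected_iff_preconnectedSpace.1 h.isConnected.isPreconnected
  have hloc : IsLocallyConstant (fun x : S => φ x) := by
    refine (IsLocallyConstant.iff_eventually_eq _).2 fun x => ?_
    obtain ⟨U, f, e, δ, η, g, hf, hxU, hg, himg, hsub⟩ := h.exists_chart x.2
    have hmem : ∀ y ∈ Metric.ball (0 : (ℝ ∙ e)ᗮ) δ, hg.param y ∈ S ∩ openCylinder (x : E) e δ η :=
      fun y hy => himg ▸ mem_image_of_mem _ hy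
    have hderiv : ∀ y ∈ Metric.ball (0 : (ℝ ∙ e)ᗮ) δ, HasFDerivWithinAt (fun y => φ (hg.param y))
        (0 : (ℝ ∙ e)ᗮ →L[ℝ] ℝ) (Metric.ball 0 δ) y := by
      intro y hy
      have hd := (hφ (hg.param y)).hasFDerivAt.comp y (hg.hasStrictFDerivAt_param hy).hasFDerivAt
      have hz : (fderiv ℝ φ (hg.param y)).comp (graphDeriv (fderiv ℝ f (hg.param y)) e) = 0 := by
        refine ContinuousLinearMap.ext fun v => h0 _ (hmem y hy).1 _ ?_
        exact hf.mem_tangentSpaceAt ⟨(hmem y hy).1, hsub (hmem y hy).2⟩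
          (apply_graphDeriv (hg.fderiv_pos _ (hmem y hy).2).ne' v)
      rw [hz] at hd
      exact hd.hasFDerivWithinAt
    have hconst : ∀ y ∈ Metric.ball (0 : (ℝ ∙ e)ᗮ) δ, ∀ z ∈ Metric.ball (0 : (ℝ ∙ e)ᗮ) δ,
        φ (hg.param y) = φ (hg.param z) := fun y hy z hz =>
      (convex_ball (0 : (ℝ ∙ e)ᗮ) δ).is_const_of_fderivWithin_eq_zero
        (f := fun y => φ (hg.param y))
        (fun w hw => (hderiv w hw).differentiableWithinAt)
        (fun w hw => (hderiv w hw).fderivWithin (Metric.isOpen_ball.uniqueDiffWithinAt hw)) hy hz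
    have hx : (x : E) ∈ openCylinder (x : E) e δ η := mem_openCylinder_self hg.δ_pos hg.η_pos
    have hev : ∀ᶠ y : S in 𝓝 x, (y : E) ∈ openCylinder (x : E) e δ η :=
      continuous_subtype_val.continuousAt ((isOpen_openCylinder _ _ _ _).mem_nhds hx)
    filter_upwards [hev] with y hy
    obtain ⟨a, ha, hay⟩ := himg.ge ⟨y.2, hy⟩
    obtain ⟨b, hb, hbx⟩ := himg.ge ⟨x.2, hx⟩
    exact (congrArg φ hay).symm.trans ((hconst a ha b hb).trans (congrArg φ hbx))
  exact hloc.apply_eq_of_preconnectedSpace ⟨p, hp⟩ ⟨q, hq⟩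

/-- The tangential derivative of a function vanishes at a maximum point on `S`. -/
theorem fderiv_apply_eq_zero_of_isMaxOn (h : IsNormalExtension Ω S N) {φ : E → ℝ} {p w : E}
    (hφ : DifferentiableAt ℝ φ p) (hp : p ∈ S) (hmax : IsMaxOn φ S p)
    (hw : w ∈ tangentSpaceAt S p) : fderiv ℝ φ p w = 0 := by
  have h2 : tangentSpaceAt S p ≤ (fderiv ℝ φ p).toLinearMap.ker := by
    obtain ⟨U, f, e, δ, η, g, hf, hpU, hg, himg, hsub⟩ := h.exists_chart hp
    have hfe := hg.fderiv_pos p (mem_openCylinder_self hg.δ_pos hg.η_pos)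
    have hp0 : hg.param 0 = p := hg.param_zero ((hf.mem_iff hpU.2).1 hp)
    have h0 : (0 : (ℝ ∙ e)ᗮ) ∈ Metric.ball 0 δ := Metric.mem_ball_self hg.δ_pos
    have hd : HasFDerivAt (fun y => φ (hg.param y))
        ((fderiv ℝ φ p).comp (graphDeriv (fderiv ℝ f p) e)) 0 := by
      have h1 := (hg.hasStrictFDerivAt_param h0).hasFDerivAt
      have h2 : HasFDerivAt φ (fderiv ℝ φ p) (hg.param 0) := by rw [hp0]; exact hφ.hasFDerivAt
      rw [hp0] at h1
      exact h2.comp 0 h1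
    have hloc : IsLocalMax (fun y => φ (hg.param y)) 0 := by
      filter_upwards [Metric.isOpen_ball.mem_nhds h0] with y hy
      rw [hp0]
      exact hmax (himg ▸ mem_image_of_mem _ hy : hg.param y ∈ S ∩ openCylinder p e δ η).1
    intro v hv
    obtain ⟨y, rfl⟩ := exists_graphDeriv_apply_eq hg.norm_eq hfe.ne' (hf.fderiv_apply_eq_zero hpU hv)
    exact congrArg (fun A : (ℝ ∙ e)ᗮ →L[ℝ] ℝ => A y) (hloc.hasFDerivAt_eq_zero hd)
  exact h2 hw

end IsNormalExtension

variable [FiniteDimensional ℝ E]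

theorem inner_gradient_eq_fderiv (f : E → ℝ) (p v : E) :
    ⟪gradient f p, v⟫_ℝ = fderiv ℝ f p v := by
  rw [gradient, InnerProductSpace.toDual_symm_apply]

namespace IsDefiningOn

variable {Ω S U : Set E} {f : E → ℝ}

theorem gradient_ne_zero (h : IsDefiningOn Ω S U f) {p : E} (hp : p ∈ U) : gradient f p ≠ 0 := by
  intro h0
  refine h.fderiv_ne p hp (ContinuousLinearMap.ext fun v => ?_)
  rw [← inner_gradient_eq_fderiv, h0]
  simp

theorem contDiffOn_gradient (h : IsDefiningOn Ω S U f) : ContDiffOn ℝ ∞ (gradient f) U := by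
  have h1 : ContDiffOn ℝ ∞ (fderiv ℝ f) U := h.contDiffOn.fderiv_of_isOpen h.isOpen (by simp)
  exact (InnerProductSpace.toDual ℝ E).symm.contDiff.comp_contDiffOn h1

theorem tangentSpaceAt_eq (h : IsDefiningOn Ω S U f) {p : E} (hp : p ∈ S ∩ U) :
    tangentSpaceAt S p = (ℝ ∙ gradient f p)ᗮ := by
  ext w
  rw [Submodule.mem_orthogonal_singleton_iff_inner_right, inner_gradient_eq_fderiv]
  exact ⟨h.fderiv_apply_eq_zero hp, h.mem_tangentSpaceAt hp⟩

/-- The normal space is the line of the gradient, so only two unit vectors compete; the side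
condition excludes the one along which f decreases. -/
theorem isOutwardUnitNormalAt_iff (h : IsDefiningOn Ω S U f) (hΩ : IsRegionEnclosedBy Ω S) {p : E}
    (hp : p ∈ S ∩ U) (v : E) :
    IsOutwardUnitNormalAt Ω S p v ↔ v = ‖gradient f p‖⁻¹ • gradient f p := by
  set G := gradient f p with hG
  have hG0 : G ≠ 0 := h.gradient_ne_zero hp.2
  have hGn : 0 < ‖G‖ := norm_pos_iff.2 hG0
  have hev : ∀ᶠ t : ℝ in 𝓝[>] 0,
      p - t • (‖G‖⁻¹ • G) ∈ Ω ∧ p + t • (‖G‖⁻¹ • G) ∉ closure Ω := by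
    have hd : HasFDerivAt f (fderiv ℝ f p) p :=
      ((h.contDiffAt hp.2).differentiableAt (by simp)).hasFDerivAt
    have h1 := hd.eventually_pos_along ((h.mem_iff hp.2).1 hp.1) (v := ‖G‖⁻¹ • G) (by
      rw [← inner_gradient_eq_fderiv, inner_smul_right, real_inner_self_eq_norm_sq]
      positivity)
    have hc : ∀ v : E, Tendsto (fun t : ℝ => p + t • v) (𝓝[>] 0) (𝓝 p) := fun v => by
      have : Continuous fun t : ℝ => p + t • v := by fun_prop
      simpa using (this.tendsto 0).mono_left (nhdsWithin_le_nhds (s := Ioi 0))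
    have h2 := (hc (‖G‖⁻¹ • G)).eventually (h.isOpen.mem_nhds hp.2)
    have h3 := (hc (-(‖G‖⁻¹ • G))).eventually (h.isOpen.mem_nhds hp.2)
    filter_upwards [h1, h2, h3] with t ht1 ht2 ht3
    simp only [smul_neg, ← sub_eq_add_neg] at ht3
    exact ⟨(h.mem_region_iff ht3).2 ht1.1, h.notMem_closure hΩ ht2 ht1.2⟩
  constructor
  · rintro ⟨hv1, hv2, hv3⟩
    rw [h.tangentSpaceAt_eq hp, Submodule.orthogonal_orthogonal, Submodule.mem_span_singleton] at hv2
    obtain ⟨c, rfl⟩ := hv2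
    rw [norm_smul, Real.norm_eq_abs] at hv1
    have hc : |c| = ‖G‖⁻¹ := eq_inv_of_mul_eq_one_left hv1
    rcases abs_choice c with h1 | h1
    · rw [← hc, h1]
    · exfalso
      have hc' : c = -‖G‖⁻¹ := by rw [← hc, h1, neg_neg]
      obtain ⟨t, ht1, ht2⟩ := (hv3.and hev).exists
      refine ht2.2 (subset_closure ?_)
      have := ht1.1
      rw [hc'] at this
      simpa using this
  · rintro rfl
    refine ⟨?_, ?_, hev⟩
    · rw [norm_smul, norm_inv, norm_norm, inv_mul_cancel₀ hGn.ne']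
    · rw [h.tangentSpaceAt_eq hp, Submodule.orthogonal_orthogonal]
      exact Submodule.smul_mem _ _ (Submodule.mem_span_singleton_self _)

theorem outwardNormal_eq (h : IsDefiningOn Ω S U f) (hΩ : IsRegionEnclosedBy Ω S) {p : E}
    (hp : p ∈ S ∩ U) : outwardNormal Ω S p = ‖gradient f p‖⁻¹ • gradient f p := by
  have hex : ∃ v, IsOutwardUnitNormalAt Ω S p v := ⟨_, (h.isOutwardUnitNormalAt_iff hΩ hp _).2 rfl⟩
  rw [outwardNormal, dif_pos hex]
  exact (h.isOutwardUnitNormalAt_iff hΩ hp _).1 hex.choose_spec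

end IsDefiningOn

-- The prescribed values form a convex set at every point, a singleton on S and everything off S.
-- Hence the local solutions, normalized gradients near S and 0 away from it, can be glued by a
-- partition of unity.
open scoped Manifold in
theorem IsRegionEnclosedBy.exists_isNormalExtension [Nontrivial E] {Ω S : Set E}
    (hΩ : IsRegionEnclosedBy Ω S) (hS : IsSmoothHypersurface S) (hcomp : IsCompact S)
    (hconn : IsConnected S) : ∃ N, IsNormalExtension Ω S N := by
  have hex : ∀ p ∈ S, ∃ U f, p ∈ U ∧ IsDefiningOn Ω S U f := fun p hp =>
    hΩ.exists_isDefiningOn hS hconn hp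
  obtain ⟨N, hN⟩ := exists_contMDiffMap_forall_mem_convex_of_local (n := (⊤ : ℕ∞)) 𝓘(ℝ, E)
    (t := fun x => {v : E | x ∈ S → v = outwardNormal Ω S x}) (fun x => by
      by_cases hx : x ∈ S
      · simp [hx]
      · simp [hx, convex_univ]) (fun x => by
      by_cases hx : x ∈ S
      · obtain ⟨U, f, hxU, hf⟩ := hex x hx
        refine ⟨U, hf.isOpen.mem_nhds hxU, fun y => ‖gradient f y‖⁻¹ • gradient f y, ?_, ?_⟩
        · rw [contMDiffOn_iff_contDiffOn]
          have h1 := hf.contDiffOn_gradient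
          exact ((h1.norm ℝ fun y hy => hf.gradient_ne_zero hy).inv
            fun y hy => (norm_pos_iff.2 (hf.gradient_ne_zero hy)).ne').smul h1
        · exact fun y hyU hyS => (hf.outwardNormal_eq hΩ ⟨hyS, hyU⟩).symm
      · exact ⟨Sᶜ, hcomp.isClosed.isOpen_compl.mem_nhds hx, fun _ => 0, contMDiffOn_const,
          fun y hy hyS => absurd hyS hy⟩)
  exact ⟨N, hΩ, hcomp, hconn, hex, N.contMDiff.contDiff, fun p hp => hN p hp⟩

namespace IsNormalExtension

variable {Ω S : Set E} {N : E → E}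

theorem eq_of_isDefiningOn (h : IsNormalExtension Ω S N) {U : Set E} {f : E → ℝ}
    (hf : IsDefiningOn Ω S U f) {p : E} (hp : p ∈ S ∩ U) :
    N p = ‖gradient f p‖⁻¹ • gradient f p := by
  rw [h.eq_outwardNormal p hp.1, hf.outwardNormal_eq h.region hp]

theorem norm_eq_one (h : IsNormalExtension Ω S N) {p : E} (hp : p ∈ S) : ‖N p‖ = 1 := by
  obtain ⟨U, f, hpU, hf⟩ := h.exists_isDefiningOn p hp
  rw [h.eq_of_isDefiningOn hf ⟨hp, hpU⟩]
  have := norm_pos_iff.2 (hf.gradient_ne_zero hpU)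
  rw [norm_smul, norm_inv, norm_norm, inv_mul_cancel₀ this.ne']

theorem tangentSpaceAt_eq (h : IsNormalExtension Ω S N) {p : E} (hp : p ∈ S) :
    tangentSpaceAt S p = (ℝ ∙ N p)ᗮ := by
  obtain ⟨U, f, hpU, hf⟩ := h.exists_isDefiningOn p hp
  have := norm_pos_iff.2 (hf.gradient_ne_zero hpU)
  rw [hf.tangentSpaceAt_eq ⟨hp, hpU⟩, h.eq_of_isDefiningOn hf ⟨hp, hpU⟩,
    Submodule.span_singleton_smul_eq (IsUnit.mk0 _ (inv_pos.2 this).ne')]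

theorem mem_tangentSpaceAt_iff (h : IsNormalExtension Ω S N) {p w : E} (hp : p ∈ S) :
    w ∈ tangentSpaceAt S p ↔ ⟪N p, w⟫_ℝ = 0 := by
  rw [h.tangentSpaceAt_eq hp, Submodule.mem_orthogonal_singleton_iff_inner_right]

theorem meanCurvature_eq (h : IsNormalExtension Ω S N) {p : E} (hp : p ∈ S) :
    meanCurvature Ω S p =
      LinearMap.trace ℝ E (fderiv ℝ N p) - ⟪fderiv ℝ N p (N p), N p⟫_ℝ := by
  rw [← trace_orthogonal_span_singleton (h.norm_eq_one hp) _ (h.tangentSpaceAt_eq hp)]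
  exact Finset.sum_congr rfl fun i _ => h.secondFundamentalForm_eq hp _ _

theorem inner_fderiv_normal (h : IsNormalExtension Ω S N) {p w : E} (hp : p ∈ S)
    (hw : w ∈ tangentSpaceAt S p) : ⟪N p, fderiv ℝ N p w⟫_ℝ = 0 := by
  have h1 := ((h.hasFDerivAt p).inner ℝ (h.hasFDerivAt p)).hasFDerivWithinAt (s := S)
  have h2 : HasFDerivWithinAt (fun _ => (1 : ℝ)) (0 : E →L[ℝ] ℝ) S p :=
    hasFDerivWithinAt_const _ _ _
  have h3 := h1.apply_eq_of_mem_tangentSpaceAt h2 (by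
    filter_upwards [self_mem_nhdsWithin] with x hx
    rw [real_inner_self_eq_norm_sq, h.norm_eq_one hx]; norm_num) hp hw
  simp only [ContinuousLinearMap.comp_apply, ContinuousLinearMap.prod_apply, fderivInnerCLM_apply,
    zero_apply] at h3
  rw [real_inner_comm (N p)] at h3
  linarith

/-- The second fundamental form is symmetric. -/
theorem inner_fderiv_symm (h : IsNormalExtension Ω S N) {p v w : E} (hp : p ∈ S)
    (hv : v ∈ tangentSpaceAt S p) (hw : w ∈ tangentSpaceAt S p) :
    ⟪fderiv ℝ N p v, w⟫_ℝ = ⟪fderiv ℝ N p w, v⟫_ℝ := by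
  obtain ⟨U, f, hpU, hf⟩ := h.exists_isDefiningOn p hp
  have hG := hf.gradient_ne_zero hpU
  have hGd : DifferentiableAt ℝ (gradient f) p :=
    ((hf.contDiffOn_gradient).contDiffAt (hf.isOpen.mem_nhds hpU)).differentiableAt (by simp)
  have hnd : DifferentiableAt ℝ (fun x => ‖gradient f x‖) p := hGd.norm ℝ hG
  have hfd : DifferentiableAt ℝ (fderiv ℝ f) p :=
    ((hf.contDiffAt hpU).fderiv_right (m := ∞) (by simp)).differentiableAt (by simp)
  -- Along S one has df(w) = |∇f| ⟪N, w⟫. Differentiating in the direction v, the term with the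
  -- derivative of |∇f| drops out because w is orthogonal to N. Symmetry is thus inherited from the
  -- Hessian of f.
  have key : ∀ v w, v ∈ tangentSpaceAt S p → w ∈ tangentSpaceAt S p →
      fderiv ℝ (fderiv ℝ f) p v w = ‖gradient f p‖ * ⟪fderiv ℝ N p v, w⟫_ℝ := by
    intro v w hv hw
    have h1 : HasFDerivWithinAt (fun x => fderiv ℝ f x w)
        ((fderiv ℝ (fderiv ℝ f) p).flip w) S p := by
      have := hfd.hasFDerivAt.clm_apply (hasFDerivAt_const w p)
      simpa using this.hasFDerivWithinAt (s := S)
    have h2 := (hnd.hasFDerivAt.mul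
      ((h.hasFDerivAt p).inner ℝ (hasFDerivAt_const w p))).hasFDerivWithinAt (s := S)
    have h3 := h1.apply_eq_of_mem_tangentSpaceAt h2 (by
      filter_upwards [self_mem_nhdsWithin, mem_nhdsWithin_of_mem_nhds (hf.isOpen.mem_nhds hpU)]
        with x hxS hxU
      have := norm_pos_iff.2 (hf.gradient_ne_zero hxU)
      change _ = ‖gradient f x‖ * ⟪N x, w⟫_ℝ
      rw [h.eq_of_isDefiningOn hf ⟨hxS, hxU⟩, inner_smul_left, inner_gradient_eq_fderiv]
      simp
      field_simp) hp hv
    simp only [ContinuousLinearMap.flip_apply, add_apply,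
      smul_apply, ContinuousLinearMap.comp_apply, smul_eq_mul,
      ContinuousLinearMap.prod_apply, fderivInnerCLM_apply, zero_apply,
      inner_zero_right, zero_add] at h3
    rw [(h.mem_tangentSpaceAt_iff hp).1 hw] at h3
    simpa using h3
  have hsymm : fderiv ℝ (fderiv ℝ f) p v w = fderiv ℝ (fderiv ℝ f) p w v :=
    (hf.contDiffAt hpU).isSymmSndFDerivAt (by
      rw [minSmoothness_of_isRCLikeNormedField]
      exact WithTop.coe_le_coe.2 (le_top : (2 : ℕ∞) ≤ ⊤)) v w
  rw [key v w hv hw, key w v hw hv] at hsymm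
  exact mul_left_cancel₀ (norm_pos_iff.2 hG).ne' hsymm

end IsNormalExtension

end NormalField

/-! ### Surface measure in charts and the local Gauss theorem -/

section Gauss

open Module

variable {E : Type*} [NormedAddCommGroup E] [InnerProductSpace ℝ E] [FiniteDimensional ℝ E]

theorem finrank_orthogonal_span_singleton_eq {e : E} (he : e ≠ 0) :
    finrank ℝ (ℝ ∙ e)ᗮ = finrank ℝ E - 1 := by
  have h1 := (ℝ ∙ e).finrank_add_finrank_orthogonal
  rw [finrank_span_singleton he] at h1
  omega

namespace IsGraphChart

variable {f : E → ℝ} {p e : E} {δ η : ℝ} {g : (ℝ ∙ e)ᗮ → ℝ}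

theorem normDet_eq (h : IsGraphChart f p e δ η g) {y : (ℝ ∙ e)ᗮ} (hy : y ∈ Metric.ball 0 δ) :
    (graphDeriv (fderiv ℝ f (h.param y)) e : (ℝ ∙ e)ᗮ →ₗ[ℝ] E).normDet =
      ‖gradient f (h.param y)‖ / fderiv ℝ f (h.param y) e := by
  have h1 : fderiv ℝ f (h.param y) = innerSL ℝ (gradient f (h.param y)) := by
    ext v; rw [innerSL_apply_apply, inner_gradient_eq_fderiv]
  have h2 := h.fderiv_pos _ (h.param_mem hy)
  rw [← inner_gradient_eq_fderiv] at h2 ⊢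
  rw [h1, normDet_graphDeriv h.norm_eq h2]

theorem continuousOn_normDet (h : IsGraphChart f p e δ η g) :
    ContinuousOn (fun y => (graphDeriv (fderiv ℝ f (h.param y)) e : (ℝ ∙ e)ᗮ →ₗ[ℝ] E).normDet)
      (Metric.ball 0 δ) := by
  refine ContinuousOn.congr (fun y hy => ?_) (fun y hy => h.normDet_eq hy)
  have h1 : ContinuousAt (fderiv ℝ f) (h.param y) :=
    ((h.contDiffAt _ (h.param_mem hy)).fderiv_right (m := 0) (by simp)).continuousAt
  have h2 : ContinuousAt (fun y => fderiv ℝ f (h.param y)) y :=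
    ContinuousAt.comp (f := h.param) h1 (h.continuousAt_param hy)
  have h3 : ContinuousAt (fun y => gradient f (h.param y)) y :=
    (InnerProductSpace.toDual ℝ E).symm.continuous.continuousAt.comp h2
  exact (h3.norm.div (h2.clm_apply continuousAt_const)
    (h.fderiv_pos _ (h.param_mem hy)).ne').continuousWithinAt

variable [MeasurableSpace E] [BorelSpace E]

theorem setIntegral_image_param (h : IsGraphChart f p e δ η g) (F : E → ℝ) :
    ∫ x in h.param '' Metric.ball 0 δ, F x ∂μHE[finrank ℝ E - 1] =
      ∫ y in Metric.ball (0 : (ℝ ∙ e)ᗮ) δ,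
        ‖gradient f (h.param y)‖ / fderiv ℝ f (h.param y) e * F (h.param y) := by
  have he : e ≠ 0 := fun h0 => by simpa [h0] using h.norm_eq
  rw [← finrank_orthogonal_span_singleton_eq he,
    setIntegral_image_euclideanHausdorffMeasure Metric.isOpen_ball
      (fun y hy => h.hasStrictFDerivAt_param hy) h.injOn_param
      (fun y _ => graphDeriv_injective _ h.norm_eq) h.continuousOn_normDet]
  refine setIntegral_congr_fun Metric.isOpen_ball.measurableSet fun y hy => ?_
  simp only [h.normDet_eq hy]

theorem measure_image_param (h : IsGraphChart f p e δ η g) :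
    μHE[finrank ℝ E - 1] (h.param '' Metric.ball 0 δ) =
      ∫⁻ y in Metric.ball (0 : (ℝ ∙ e)ᗮ) δ,
        ENNReal.ofReal (‖gradient f (h.param y)‖ / fderiv ℝ f (h.param y) e) := by
  have he : e ≠ 0 := fun h0 => by simpa [h0] using h.norm_eq
  rw [← finrank_orthogonal_span_singleton_eq he,
    euclideanHausdorffMeasure_image_eq_lintegral Metric.isOpen_ball
      (fun y hy => h.hasStrictFDerivAt_param hy) h.injOn_param
      (fun y _ => graphDeriv_injective _ h.norm_eq) h.continuousOn_normDet]
  refine setLIntegral_congr_fun Metric.isOpen_ball.measurableSet fun y hy => ?_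
  simp only [h.normDet_eq hy]

end IsGraphChart

variable [MeasurableSpace E] [BorelSpace E]

theorem exists_measurePreserving_cylinder (p : E) {e : E} (he : ‖e‖ = 1) :
    ∃ Φ : (ℝ ∙ e)ᗮ × ℝ ≃ᵐ E, MeasurePreserving Φ ∧ ∀ w, Φ w = p + w.1 + w.2 • e := by
  have h1 := ((ℝ ∙ e).measurePreserving_measurableEquivProd p).symm
  rw [InnerProductSpace.euclideanHausdorffMeasure_eq_volume] at h1
  set ι := LinearIsometryEquiv.toSpanUnitSingleton (𝕜 := ℝ) e he
  have h2 : MeasurePreserving ι := ι.measurePreserving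
  have h3 : MeasurePreserving (Prod.map ι (id : (ℝ ∙ e)ᗮ → (ℝ ∙ e)ᗮ)) :=
    h2.prod (MeasurePreserving.id volume)
  have h4 : MeasurePreserving (Prod.swap : (ℝ ∙ e)ᗮ × ℝ → ℝ × (ℝ ∙ e)ᗮ) :=
    Measure.measurePreserving_swap
  refine ⟨(MeasurableEquiv.prodComm.trans
    (MeasurableEquiv.prodCongr ι.toHomeomorph.toMeasurableEquiv (MeasurableEquiv.refl _))).trans
    ((ℝ ∙ e).measurableEquivProd p).symm, h1.comp (h3.comp h4), fun w => ?_⟩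
  simp [ι, MeasurableEquiv.prodCongr, MeasurableEquiv.prodComm]
  abel

/-- Gauss' theorem for functions supported in a cylinder in which the region lies below a graph. -/
theorem IsGraphChart.setIntegral_fderiv_eq {Ω : Set E} {f : E → ℝ} {p e : E} {δ η : ℝ}
    {g : (ℝ ∙ e)ᗮ → ℝ} (hg : IsGraphChart f p e δ η g) (hΩ : IsOpen Ω)
    (hΩf : ∀ x ∈ openCylinder p e δ η, x ∈ Ω ↔ f x < 0) {k : E → ℝ} (hk : ContDiff ℝ 1 k)
    (hc : HasCompactSupport k) (hsupp : tsupport k ⊆ openCylinder p e δ η) :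
    ∫ x in Ω, fderiv ℝ k x e = ∫ y in Metric.ball (0 : (ℝ ∙ e)ᗮ) δ, k (hg.param y) := by
  obtain ⟨Φ, hΦ, hΦa⟩ := exists_measurePreserving_cylinder p hg.norm_eq
  set F : E → ℝ := Ω.indicator fun x => fderiv ℝ k x e with hF
  have hkc : Continuous fun x => fderiv ℝ k x e :=
    (hk.continuous_fderiv one_ne_zero).clm_apply continuous_const
  have hkcs : HasCompactSupport fun x => fderiv ℝ k x e := hc.fderiv_apply ℝ e
  have hFi : Integrable F := (hkc.integrable_of_hasCompactSupport hkcs).indicator hΩ.measurableSet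
  have hzero : ∀ x, x ∉ openCylinder p e δ η → fderiv ℝ k x = 0 := fun x hx =>
    image_eq_zero_of_notMem_tsupport fun h => hx (hsupp (tsupport_fderiv_subset ℝ h))
  rw [← integral_indicator hΩ.measurableSet, ← hF, ← hΦ.integral_comp' F]
  have hFi' : Integrable (fun w => F (Φ w)) (volume : Measure ((ℝ ∙ e)ᗮ × ℝ)) :=
    (hΦ.integrable_comp_emb Φ.measurableEmbedding).2 hFi
  rw [Measure.volume_eq_prod] at hFi' ⊢
  rw [integral_prod _ hFi', ← integral_indicator Metric.isOpen_ball.measurableSet]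
  refine integral_congr_ae (Eventually.of_forall fun y => ?_)
  simp only [hΦa]
  by_cases hy : y ∈ Metric.ball (0 : (ℝ ∙ e)ᗮ) δ
  swap
  · rw [indicator_of_notMem hy, integral_eq_zero_of_ae]
    refine Eventually.of_forall fun t => ?_
    have : p + (y : E) + t • e ∉ openCylinder p e δ η := fun h =>
      hy (mem_ball_zero_iff.2 ((mem_openCylinder_iff hg.norm_eq _ _).1 h).1)
    simp only [hF, indicator, hzero _ this]
    simp
  · rw [indicator_of_mem hy]
    have hline : ContDiff ℝ 1 fun t : ℝ => k (p + y + t • e) := hk.comp (by fun_prop)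
    have hder : ∀ t : ℝ, deriv (fun t : ℝ => k (p + y + t • e)) t =
        fderiv ℝ k (p + y + t • e) e := fun t => by
      have h2 : HasDerivAt (fun t : ℝ => p + (y : E) + t • e) e t := by
        simpa using ((hasDerivAt_id t).smul_const e).const_add (p + (y : E))
      exact ((hk.differentiable one_ne_zero _).hasFDerivAt.comp_hasDerivAt t h2).deriv
    have hcs : HasCompactSupport fun t : ℝ => k (p + y + t • e) := by
      refine HasCompactSupport.of_support_subset_isCompact (isCompact_Icc (a := -η) (b := η)) ?_
      intro t ht
      have h1 : p + (y : E) + t • e ∈ openCylinder p e δ η := hsupp (subset_tsupport _ ht)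
      exact _root_.abs_le.1 ((mem_openCylinder_iff hg.norm_eq _ _).1 h1).2.le
    -- On the vertical line over y, within the cylinder, Ω is the part below the graph; compact
    -- support leaves only the boundary term at height g y.
    have hval := hcs.integral_Iic_deriv_eq hline (g y)
    rw [IsGraphChart.param, ← hval, integral_Iic_eq_integral_Iio, ← integral_indicator measurableSet_Iio]
    congr 1
    ext t
    by_cases ht : |t| < η
    · have hmem : p + (y : E) + t • e ∈ openCylinder p e δ η :=
        (mem_openCylinder_iff hg.norm_eq _ _).2 ⟨mem_ball_zero_iff.1 hy, ht⟩
      have hiff := (hΩf _ hmem).trans (hg.neg_iff y hy t ht)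
      by_cases hlt : t < g y
      · rw [hF, indicator_of_mem (hiff.2 hlt), indicator_of_mem (mem_Iio.2 hlt), hder]
      · rw [hF, indicator_of_notMem fun h => hlt (hiff.1 h),
          indicator_of_notMem (show t ∉ Iio (g y) from hlt)]
    · have hmem : p + (y : E) + t • e ∉ openCylinder p e δ η := fun h =>
        ht ((mem_openCylinder_iff hg.norm_eq _ _).1 h).2
      simp only [hF, indicator, hder, hzero _ hmem]
      simp

namespace IsNormalExtension

variable {Ω S : Set E} {N : E → E}

/-- Gauss' theorem in a cylinder. -/
theorem setIntegral_fderiv_of_tsupport_subset (h : IsNormalExtension Ω S N) {U : Set E} {f : E → ℝ}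
    (hf : IsDefiningOn Ω S U f) {p e : E} {δ η : ℝ} {g : (ℝ ∙ e)ᗮ → ℝ}
    (hg : IsGraphChart f p e δ η g) (hsub : openCylinder p e δ η ⊆ U) {k : E → ℝ}
    (hk : ContDiff ℝ 1 k) (hc : HasCompactSupport k) (hsupp : tsupport k ⊆ openCylinder p e δ η) :
    ∫ x in Ω, fderiv ℝ k x e = ∫ x in S, k x * ⟪N x, e⟫_ℝ ∂μHE[finrank ℝ E - 1] := by
  rw [hg.setIntegral_fderiv_eq h.region.isOpen (fun x hx => hf.mem_region_iff (hsub hx)) hk hc hsupp]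
  rw [setIntegral_eq_of_subset_of_forall_sdiff_eq_zero (s := S ∩ openCylinder p e δ η)
    h.isCompact.isClosed.measurableSet inter_subset_left]
  swap
  · intro x hx
    have : x ∉ tsupport k := fun h => hx.2 ⟨hx.1, hsupp h⟩
    rw [image_eq_zero_of_notMem_tsupport this, zero_mul]
  rw [← hf.image_param hg hsub, hg.setIntegral_image_param]
  -- The area density |∇f| / ∂ₑf cancels the factor ⟪N, e⟫ = ∂ₑf / |∇f|.
  refine setIntegral_congr_fun Metric.isOpen_ball.measurableSet fun y hy => ?_
  have hmem : hg.param y ∈ S ∩ openCylinder p e δ η :=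
    hf.image_param hg hsub ▸ mem_image_of_mem _ hy
  have h1 := hg.fderiv_pos _ hmem.2
  have h2 := norm_pos_iff.2 (hf.gradient_ne_zero (hsub hmem.2))
  rw [h.eq_of_isDefiningOn hf ⟨hmem.1, hsub hmem.2⟩, inner_smul_left, inner_gradient_eq_fderiv]
  simp
  field_simp

/-- The hypersurface has finite area. -/
theorem measure_lt_top (h : IsNormalExtension Ω S N) : μHE[finrank ℝ E - 1] S < ⊤ := by
  refine h.isCompact.measure_lt_top_of_nhdsWithin fun p hp => ?_
  obtain ⟨U, f, hpU, hf⟩ := h.exists_isDefiningOn p hp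
  obtain ⟨e, he, hae⟩ := exists_norm_eq_one_apply_pos (hf.fderiv_ne p hpU)
  have hcont : ContinuousAt (fun x => ‖gradient f x‖ / fderiv ℝ f x e) p :=
    ((hf.contDiffOn_gradient.continuousOn.continuousAt (hf.isOpen.mem_nhds hpU)).norm).div
      (((hf.contDiffAt hpU).fderiv_right (m := 0) (by simp)).continuousAt.clm_apply
        continuousAt_const) hae.ne'
  -- The cylinder is taken so small that the area density stays below its value at p plus one.
  obtain ⟨δ, η, g, hg, hsub⟩ := hf.exists_isGraphChart ⟨hp, hpU⟩ he hae
    (hcont.eventually (eventually_lt_nhds (lt_add_one _)))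
  have himg := hf.image_param hg (hsub.trans inter_subset_right)
  refine ⟨S ∩ openCylinder p e δ η, inter_mem_nhdsWithin _ ((isOpen_openCylinder _ _ _ _).mem_nhds
    (mem_openCylinder_self hg.δ_pos hg.η_pos)), ?_⟩
  rw [← himg, hg.measure_image_param]
  refine (setLIntegral_mono' (g := fun _ => ENNReal.ofReal (‖gradient f p‖ / fderiv ℝ f p e + 1))
    Metric.isOpen_ball.measurableSet fun y hy => ?_).trans_lt ?_
  · exact ENNReal.ofReal_le_ofReal (hsub (hg.param_mem hy)).1.le
  · rw [setLIntegral_const]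
    exact ENNReal.mul_lt_top ENNReal.ofReal_lt_top measure_ball_lt_top

/-- Relatively open pieces of the hypersurface have positive area. -/
theorem measure_inter_pos (h : IsNormalExtension Ω S N) {p : E} (hp : p ∈ S) {W : Set E}
    (hW : W ∈ 𝓝 p) : 0 < μHE[finrank ℝ E - 1] (S ∩ W) := by
  obtain ⟨U, f, hpU, hf⟩ := h.exists_isDefiningOn p hp
  obtain ⟨e, he, hae⟩ := exists_norm_eq_one_apply_pos (hf.fderiv_ne p hpU)
  obtain ⟨δ, η, g, hg, hsub⟩ := hf.exists_isGraphChart ⟨hp, hpU⟩ he hae hW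
  have himg := hf.image_param hg (hsub.trans inter_subset_right)
  have h1 : μHE[finrank ℝ E - 1] (hg.param '' Metric.ball 0 δ) ≤ μHE[finrank ℝ E - 1] (S ∩ W) := by
    rw [himg]
    exact measure_mono (inter_subset_inter_right _ (hsub.trans inter_subset_left))
  refine lt_of_lt_of_le ?_ h1
  rw [hg.measure_image_param]
  refine (Metric.measure_ball_pos (volume : Measure (ℝ ∙ e)ᗮ) 0 hg.δ_pos).trans_le ?_
  rw [← setLIntegral_one]
  refine setLIntegral_mono' Metric.isOpen_ball.measurableSet fun y hy => ?_
  rw [← ENNReal.ofReal_one]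
  refine ENNReal.ofReal_le_ofReal ?_
  -- The area density is at least 1, since ∂ₑf ≤ |∇f| for a unit vector e.
  rw [one_le_div (hg.fderiv_pos _ (hg.param_mem hy)), ← inner_gradient_eq_fderiv]
  simpa [hg.norm_eq] using real_inner_le_norm (gradient f (hg.param y)) e

end IsNormalExtension

end Gauss

/-! ### Gauss' theorem on the whole region -/

section GlobalGauss

open Module

variable {E : Type*} [NormedAddCommGroup E] [InnerProductSpace ℝ E] [FiniteDimensional ℝ E]
  [MeasurableSpace E] [BorelSpace E]

theorem integral_fderiv_eq_zero_of_hasCompactSupport {k : E → ℝ} (hk : ContDiff ℝ 1 k)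
    (hc : HasCompactSupport k) (v : E) : ∫ x, fderiv ℝ k x v = 0 := by
  have hi : Integrable fun x => fderiv ℝ k x v :=
    ((hk.continuous_fderiv one_ne_zero).clm_apply continuous_const).integrable_of_hasCompactSupport
      (hc.fderiv_apply ℝ v)
  have := integral_mul_fderiv_eq_neg_fderiv_mul_of_integrable (μ := (volume : Measure E))
    (f := fun _ => (1 : ℝ)) (g := k) (v := v) (𝕜 := ℝ) (by simp) (by simpa using hi)
    (by simpa using hk.continuous.integrable_of_hasCompactSupport hc)
    (fun x _ => differentiableAt_const _) (fun x _ => hk.differentiable one_ne_zero x)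
  simpa using this

namespace IsNormalExtension

variable {Ω S : Set E} {N : E → E}

theorem integrableOn (h : IsNormalExtension Ω S N) {F : E → ℝ} (hF : Continuous F) :
    IntegrableOn F S μHE[finrank ℝ E - 1] := by
  obtain ⟨C, hC⟩ := h.isCompact.exists_bound_of_continuousOn hF.continuousOn
  exact Measure.integrableOn_of_bounded h.measure_lt_top.ne hF.aestronglyMeasurable
    ((ae_restrict_mem h.isCompact.isClosed.measurableSet).mono fun x hx => hC x hx)

/-- Away from S both sides vanish. At a point of S a cylinder only treats directions transversal to
S, so v is written as a combination of two of these and linearity gives the rest. -/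
theorem exists_nhds_setIntegral_fderiv_eq (h : IsNormalExtension Ω S N) (v p : E) :
    ∃ W ∈ 𝓝 p, ∀ k : E → ℝ, ContDiff ℝ 1 k → HasCompactSupport k → tsupport k ⊆ W →
      ∫ x in Ω, fderiv ℝ k x v = ∫ x in S, k x * ⟪N x, v⟫_ℝ ∂μHE[finrank ℝ E - 1] := by
  have hS0 : ∀ k : E → ℝ, tsupport k ⊆ Sᶜ →
      ∫ x in S, k x * ⟪N x, v⟫_ℝ ∂μHE[finrank ℝ E - 1] = 0 := fun k hk => by
    refine (setIntegral_congr_fun h.isCompact.isClosed.measurableSet fun x hx => ?_).trans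
      (integral_zero _ _)
    simp [image_eq_zero_of_notMem_tsupport fun h => hk h hx]
  by_cases hp : p ∈ S
  swap
  · by_cases hpΩ : p ∈ Ω
    · refine ⟨Ω, h.region.isOpen.mem_nhds hpΩ, fun k hk hc hkΩ => ?_⟩
      rw [hS0 k (hkΩ.trans h.region.disjoint.subset_compl_right),
        setIntegral_eq_integral_of_forall_compl_eq_zero fun x hx => ?_,
        integral_fderiv_eq_zero_of_hasCompactSupport hk hc]
      rw [image_eq_zero_of_notMem_tsupport fun h => hx (hkΩ (tsupport_fderiv_subset ℝ h))]
      rfl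
    · have hpc : p ∉ closure Ω := by rw [h.region.closure_eq]; exact fun h => h.elim hpΩ hp
      refine ⟨(closure Ω)ᶜ, isClosed_closure.isOpen_compl.mem_nhds hpc, fun k hk hc hkΩ => ?_⟩
      rw [hS0 k (hkΩ.trans (compl_subset_compl.2 (by rw [h.region.closure_eq]; exact subset_union_right)))]
      refine (setIntegral_congr_fun h.region.isOpen.measurableSet fun x hx => ?_).trans
        (integral_zero _ _)
      rw [image_eq_zero_of_notMem_tsupport fun h =>
        hkΩ (tsupport_fderiv_subset ℝ h) (subset_closure hx)]
      rfl
  obtain ⟨U, f, hpU, hf⟩ := h.exists_isDefiningOn p hp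
  obtain ⟨u, hu, hau⟩ := exists_norm_eq_one_apply_pos (hf.fderiv_ne p hpU)
  set a := fderiv ℝ f p
  -- Chosen so that a(v + M u) = a v + |a v| + 1 > 0, whatever the sign of a v.
  set M := (|a v| + 1) / a u
  set w := v + M • u with hw
  have haw : 0 < a w := by
    have : M * a u = |a v| + 1 := div_mul_cancel₀ _ hau.ne'
    rw [hw, map_add, map_smul, smul_eq_mul, this]
    linarith [neg_abs_le (a v)]
  have hwn : 0 < ‖w‖ := norm_pos_iff.2 fun h0 => by simp [h0] at haw
  set w' := ‖w‖⁻¹ • w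
  have hw'n : ‖w'‖ = 1 := by rw [norm_smul, norm_inv, norm_norm, inv_mul_cancel₀ hwn.ne']
  have haw' : 0 < a w' := by rw [map_smul, smul_eq_mul]; positivity
  obtain ⟨δ₁, η₁, g₁, hg₁, hsub₁⟩ := hf.exists_isGraphChart ⟨hp, hpU⟩ hu hau univ_mem
  obtain ⟨δ₂, η₂, g₂, hg₂, hsub₂⟩ := hf.exists_isGraphChart ⟨hp, hpU⟩ hw'n haw' univ_mem
  refine ⟨openCylinder p u δ₁ η₁ ∩ openCylinder p w' δ₂ η₂, ((isOpen_openCylinder _ _ _ _).inter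
    (isOpen_openCylinder _ _ _ _)).mem_nhds ⟨mem_openCylinder_self hg₁.δ_pos hg₁.η_pos,
      mem_openCylinder_self hg₂.δ_pos hg₂.η_pos⟩, fun k hk hc hkW => ?_⟩
  have e1 := h.setIntegral_fderiv_of_tsupport_subset hf hg₁ (hsub₁.trans inter_subset_right) hk hc
    (hkW.trans inter_subset_left)
  have e2 := h.setIntegral_fderiv_of_tsupport_subset hf hg₂ (hsub₂.trans inter_subset_right) hk hc
    (hkW.trans inter_subset_right)
  have hv : v = ‖w‖ • w' - M • u := by
    simp only [w']
    rw [smul_smul, mul_inv_cancel₀ hwn.ne', one_smul, hw, add_sub_cancel_right]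
  clear_value w'
  have hi : ∀ z, IntegrableOn (fun x => fderiv ℝ k x z) Ω := fun z =>
    (((hk.continuous_fderiv one_ne_zero).clm_apply continuous_const).integrable_of_hasCompactSupport
      (hc.fderiv_apply ℝ z)).integrableOn
  have hiS : ∀ z, IntegrableOn (fun x => k x * ⟪N x, z⟫_ℝ) S μHE[finrank ℝ E - 1] := fun z =>
    h.integrableOn (hk.continuous.mul (h.contDiff.continuous.inner continuous_const))
  have l1 : ∀ x, fderiv ℝ k x v = ‖w‖ * fderiv ℝ k x w' - M * fderiv ℝ k x u := fun x => by
    conv_lhs => rw [hv]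
    rw [map_sub, map_smul, map_smul, smul_eq_mul, smul_eq_mul]
  have l2 : ∀ x, k x * ⟪N x, v⟫_ℝ = ‖w‖ * (k x * ⟪N x, w'⟫_ℝ) - M * (k x * ⟪N x, u⟫_ℝ) := fun x => by
    conv_lhs => rw [hv]
    rw [inner_sub_right, inner_smul_right, inner_smul_right]; ring
  simp only [l1, l2]
  rw [integral_sub ((hi w').const_mul _) ((hi u).const_mul _),
    integral_sub ((hiS w').const_mul _) ((hiS u).const_mul _), integral_const_mul,
    integral_const_mul, integral_const_mul, integral_const_mul, e1, e2]

open scoped Manifold in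
theorem setIntegral_fderiv_eq_of_hasCompactSupport (h : IsNormalExtension Ω S N) {k : E → ℝ}
    (hk : ContDiff ℝ 1 k) (hc : HasCompactSupport k) (v : E) :
    ∫ x in Ω, fderiv ℝ k x v = ∫ x in S, k x * ⟪N x, v⟫_ℝ ∂μHE[finrank ℝ E - 1] := by
  classical
  choose W hW hWk using h.exists_nhds_setIntegral_fderiv_eq v
  obtain ⟨ρ, hρ⟩ := SmoothPartitionOfUnity.exists_isSubordinate 𝓘(ℝ, E) (isClosed_univ (X := E))
    (fun p => interior (W p)) (fun p => isOpen_interior)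
    (fun p _ => mem_iUnion.2 ⟨p, mem_interior_iff_mem_nhds.2 (hW p)⟩)
  have hfin : {i | (Function.support (ρ i) ∩ tsupport k).Nonempty}.Finite :=
    ρ.locallyFinite.finite_nonempty_inter_compact hc
  set F := hfin.toFinset
  have hρd : ∀ i, ContDiff ℝ 1 (ρ i) := fun i =>
    ((ρ i).contMDiff.contDiff).of_le (WithTop.coe_le_coe.2 le_top)
  have hsum : k = fun x => ∑ i ∈ F, ρ i x * k x := by
    ext x
    rw [← Finset.sum_mul]
    by_cases hx : x ∈ tsupport k
    · have h1 : ∑ᶠ i, ρ i x = 1 := ρ.sum_eq_one (mem_univ x)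
      rw [finsum_eq_sum_of_support_subset (s := F)] at h1
      · rw [h1, one_mul]
      · intro i hi
        simp only [F, Finite.coe_toFinset]
        exact ⟨x, hi, hx⟩
    · rw [image_eq_zero_of_notMem_tsupport hx, mul_zero]
  have hd : ∀ i, ContDiff ℝ 1 fun x => ρ i x * k x := fun i => (hρd i).mul hk
  have hcs : ∀ i, HasCompactSupport fun x => ρ i x * k x := fun i => hc.mul_left
  have heach : ∀ i, ∫ x in Ω, fderiv ℝ (fun x => ρ i x * k x) x v =
      ∫ x in S, (ρ i x * k x) * ⟪N x, v⟫_ℝ ∂μHE[finrank ℝ E - 1] := fun i =>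
    hWk i _ (hd i) (hcs i) ((tsupport_mul_subset_left).trans ((hρ i).trans interior_subset))
  have l1 : ∀ x, fderiv ℝ k x v = ∑ i ∈ F, fderiv ℝ (fun x => ρ i x * k x) x v := fun x => by
    conv_lhs => rw [hsum]
    rw [fderiv_fun_sum fun i _ => (hd i).differentiable one_ne_zero x]
    simp
  have l2 : ∀ x, k x * ⟪N x, v⟫_ℝ = ∑ i ∈ F, (ρ i x * k x) * ⟪N x, v⟫_ℝ := fun x => by
    rw [← Finset.sum_mul, ← congrFun hsum x]
  simp only [l1]
  rw [integral_finsetSum]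
  · simp only [l2]
    rw [integral_finsetSum]
    · exact Finset.sum_congr rfl fun i _ => heach i
    · exact fun i _ => h.integrableOn
        ((hd i).continuous.mul (h.contDiff.continuous.inner continuous_const))
  · exact fun i _ => ((((hd i).continuous_fderiv one_ne_zero).clm_apply
      continuous_const).integrable_of_hasCompactSupport ((hcs i).fderiv_apply ℝ v)).integrableOn

/-- Gauss' theorem. -/
theorem setIntegral_fderiv_eq (h : IsNormalExtension Ω S N) {k : E → ℝ}
    (hk : ContDiff ℝ 1 k) (v : E) :
    ∫ x in Ω, fderiv ℝ k x v = ∫ x in S, k x * ⟪N x, v⟫_ℝ ∂μHE[finrank ℝ E - 1] := by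
  obtain ⟨R, hR0, hR⟩ := h.region.isBounded.closure.subset_ball_lt 0 (0 : E)
  -- A cutoff equal to 1 near the closure of Ω changes neither integral and removes the need for
  -- compact support.
  let χ : ContDiffBump (0 : E) := ⟨R, R + 1, hR0, by linarith⟩
  have hχ : ∀ x ∈ closure Ω, (χ : E → ℝ) =ᶠ[𝓝 x] fun _ => 1 := fun x hx => by
    filter_upwards [Metric.isOpen_ball.mem_nhds (hR hx)] with y hy
    exact χ.one_of_mem_closedBall (Metric.ball_subset_closedBall hy)
  have hd : ContDiff ℝ 1 fun x => χ x * k x := χ.contDiff.mul hk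
  have key := h.setIntegral_fderiv_eq_of_hasCompactSupport hd (χ.hasCompactSupport.mul_right) v
  convert key using 1
  · refine setIntegral_congr_fun h.region.isOpen.measurableSet fun x hx => ?_
    have : (fun x => χ x * k x) =ᶠ[𝓝 x] k := by
      filter_upwards [hχ x (subset_closure hx)] with y hy
      rw [hy, one_mul]
    simp only [this.fderiv_eq]
  · refine setIntegral_congr_fun h.isCompact.isClosed.measurableSet fun x hx => ?_
    have : x ∈ closure Ω := by rw [h.region.closure_eq]; exact Or.inr hx
    simp only [(hχ x this).self_of_nhds, one_mul]

/-- A curl-type identity on the closed hypersurface. -/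
theorem setIntegral_fderiv_mul_inner_sub_eq_zero (h : IsNormalExtension Ω S N) {k : E → ℝ}
    (hk : ContDiff ℝ 2 k) (v w : E) :
    ∫ x in S, (fderiv ℝ k x w * ⟪N x, v⟫_ℝ - fderiv ℝ k x v * ⟪N x, w⟫_ℝ) ∂μHE[finrank ℝ E - 1]
      = 0 := by
  have hd : ∀ z, ContDiff ℝ 1 fun x => fderiv ℝ k x z := fun z =>
    (hk.fderiv_right (m := 1) (by norm_num)).clm_apply contDiff_const
  have hi : ∀ z y, IntegrableOn (fun x => fderiv ℝ k x z * ⟪N x, y⟫_ℝ) S μHE[finrank ℝ E - 1] :=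
    fun z y => h.integrableOn
      ((hd z).continuous.mul (h.contDiff.continuous.inner continuous_const))
  -- Gauss' theorem turns the two terms into integrals over Ω of the mixed second derivatives of k
  -- in the two orders.
  rw [integral_sub (hi w v) (hi v w), ← h.setIntegral_fderiv_eq (hd w), ← h.setIntegral_fderiv_eq (hd v), sub_eq_zero]
  refine setIntegral_congr_fun h.region.isOpen.measurableSet fun x hx => ?_
  have hfd : DifferentiableAt ℝ (fderiv ℝ k) x :=
    (hk.fderiv_right (m := 1) (by norm_num)).differentiable one_ne_zero x
  have hval : ∀ z y, fderiv ℝ (fun x => fderiv ℝ k x z) x y = fderiv ℝ (fderiv ℝ k) x y z := by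
    intro z y
    have := hfd.hasFDerivAt.clm_apply (hasFDerivAt_const z x)
    rw [this.fderiv]; simp
  simp only [hval]
  exact (hk.contDiffAt.isSymmSndFDerivAt (by simp)) v w

end IsNormalExtension

end GlobalGauss

/-! ### The integral identity for r²H -/

section TangentialIdentity

open Module

variable {E : Type*} [NormedAddCommGroup E] [InnerProductSpace ℝ E]

theorem OrthonormalBasis.sum_apply_mul_inner {ι : Type*} [Fintype ι] (b : OrthonormalBasis ι ℝ E)
    (α : E →L[ℝ] ℝ) (x : E) : ∑ j, α (b j) * ⟪x, b j⟫_ℝ = α x := by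
  conv_rhs => rw [← b.sum_repr' x, map_sum]
  refine Finset.sum_congr rfl fun j _ => ?_
  rw [map_smul, smul_eq_mul, real_inner_comm, mul_comm]

/-- The normal component of the divergence of the bivector field `⟪X, N⟫ (X ∧ N)`. -/
theorem OrthonormalBasis.sum_sum_curl_eq {ι : Type*} [Fintype ι] (b : OrthonormalBasis ι ℝ E)
    (D : E →L[ℝ] E) (X : E) {N : E} (hN : ‖N‖ = 1) :
    ∑ i, ∑ j,
      (((⟪b j, N⟫_ℝ + ⟪X, D (b j)⟫_ℝ) * ⟪X, b i⟫_ℝ * ⟪N, b j⟫_ℝ +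
          ⟪X, N⟫_ℝ * ⟪b j, b i⟫_ℝ * ⟪N, b j⟫_ℝ + ⟪X, N⟫_ℝ * ⟪X, b i⟫_ℝ * ⟪D (b j), b j⟫_ℝ) *
            ⟪N, b i⟫_ℝ -
        ((⟪b i, N⟫_ℝ + ⟪X, D (b i)⟫_ℝ) * ⟪X, b i⟫_ℝ * ⟪N, b j⟫_ℝ +
          ⟪X, N⟫_ℝ * ⟪b i, b i⟫_ℝ * ⟪N, b j⟫_ℝ + ⟪X, N⟫_ℝ * ⟪X, b i⟫_ℝ * ⟪D (b i), b j⟫_ℝ) *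
            ⟪N, b j⟫_ℝ) =
      ⟪X, N⟫_ℝ ^ 2 * ∑ j, ⟪D (b j), b j⟫_ℝ - (Fintype.card ι - 1) * ⟪X, N⟫_ℝ +
        ⟪X, N⟫_ℝ * ⟪X, D N⟫_ℝ - ⟪X, D X⟫_ℝ - ⟪X, N⟫_ℝ * ⟪D X, N⟫_ℝ := by
  have hNN : ⟪N, N⟫_ℝ = 1 := by rw [real_inner_self_eq_norm_sq, hN]; norm_num
  -- For X = x - O and D the derivative of the normal field, this is the differential of u = ⟪x - O,
  -- N⟫.
  set α : E →L[ℝ] ℝ := innerSL ℝ N + (innerSL ℝ X).comp D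
  have hα : ∀ w, α w = ⟪w, N⟫_ℝ + ⟪X, D w⟫_ℝ := fun w => by
    simp [α, real_inner_comm]
  have f2 : ∀ x y : E, ∑ i, ⟪x, b i⟫_ℝ * ⟪y, b i⟫_ℝ = ⟪x, y⟫_ℝ := fun x y => by
    simpa using b.sum_apply_mul_inner (innerSL ℝ x) y
  have t1 : ∑ i, ∑ j, (α (b j) * ⟪N, b j⟫_ℝ) * (⟪X, b i⟫_ℝ * ⟪N, b i⟫_ℝ) = α N * ⟪X, N⟫_ℝ := by
    rw [Finset.sum_comm, ← Finset.sum_mul_sum, b.sum_apply_mul_inner, f2]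
  have t2 : ∑ i, ∑ j, (⟪b j, b i⟫_ℝ * ⟪N, b j⟫_ℝ) * ⟪N, b i⟫_ℝ = 1 := by
    rw [← hNN, ← f2 N N]
    refine Finset.sum_congr rfl fun i _ => ?_
    rw [← Finset.sum_mul]
    congr 1
    rw [← f2 N (b i)]
    exact Finset.sum_congr rfl fun j _ => by rw [real_inner_comm (b j) (b i)]; ring
  have t3 : ∑ i, ∑ j, (⟪X, b i⟫_ℝ * ⟪N, b i⟫_ℝ) * ⟪D (b j), b j⟫_ℝ =
      ⟪X, N⟫_ℝ * ∑ j, ⟪D (b j), b j⟫_ℝ := by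
    rw [← Finset.sum_mul_sum, f2]
  have t4 : ∑ i, ∑ j, (α (b i) * ⟪X, b i⟫_ℝ) * (⟪N, b j⟫_ℝ * ⟪N, b j⟫_ℝ) = α X := by
    rw [← Finset.sum_mul_sum, b.sum_apply_mul_inner, f2, hNN, mul_one]
  have t5 : ∑ i : ι, ∑ j, ⟪b i, b i⟫_ℝ * (⟪N, b j⟫_ℝ * ⟪N, b j⟫_ℝ) = Fintype.card ι := by
    rw [← Finset.sum_mul_sum, f2, hNN]
    simp
  have t6 : ∑ i, ∑ j, ⟪X, b i⟫_ℝ * (⟪D (b i), b j⟫_ℝ * ⟪N, b j⟫_ℝ) = ⟪D X, N⟫_ℝ := by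
    have := b.sum_apply_mul_inner ((innerSL ℝ N).comp D) X
    simp only [ContinuousLinearMap.comp_apply, innerSL_apply_apply] at this
    rw [real_inner_comm, ← this]
    refine Finset.sum_congr rfl fun i _ => ?_
    rw [← Finset.mul_sum, f2, mul_comm, real_inner_comm]
  have expand : ∀ i j, (((⟪b j, N⟫_ℝ + ⟪X, D (b j)⟫_ℝ) * ⟪X, b i⟫_ℝ * ⟪N, b j⟫_ℝ +
          ⟪X, N⟫_ℝ * ⟪b j, b i⟫_ℝ * ⟪N, b j⟫_ℝ + ⟪X, N⟫_ℝ * ⟪X, b i⟫_ℝ * ⟪D (b j), b j⟫_ℝ) *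
            ⟪N, b i⟫_ℝ -
        ((⟪b i, N⟫_ℝ + ⟪X, D (b i)⟫_ℝ) * ⟪X, b i⟫_ℝ * ⟪N, b j⟫_ℝ +
          ⟪X, N⟫_ℝ * ⟪b i, b i⟫_ℝ * ⟪N, b j⟫_ℝ + ⟪X, N⟫_ℝ * ⟪X, b i⟫_ℝ * ⟪D (b i), b j⟫_ℝ) *
            ⟪N, b j⟫_ℝ) =
      (α (b j) * ⟪N, b j⟫_ℝ) * (⟪X, b i⟫_ℝ * ⟪N, b i⟫_ℝ) +
        ⟪X, N⟫_ℝ * ((⟪b j, b i⟫_ℝ * ⟪N, b j⟫_ℝ) * ⟪N, b i⟫_ℝ) +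
        ⟪X, N⟫_ℝ * ((⟪X, b i⟫_ℝ * ⟪N, b i⟫_ℝ) * ⟪D (b j), b j⟫_ℝ) -
        (α (b i) * ⟪X, b i⟫_ℝ) * (⟪N, b j⟫_ℝ * ⟪N, b j⟫_ℝ) -
        ⟪X, N⟫_ℝ * (⟪b i, b i⟫_ℝ * (⟪N, b j⟫_ℝ * ⟪N, b j⟫_ℝ)) -
        ⟪X, N⟫_ℝ * (⟪X, b i⟫_ℝ * (⟪D (b i), b j⟫_ℝ * ⟪N, b j⟫_ℝ)) := fun i j => by
    rw [hα, hα]; ring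
  simp only [expand, Finset.sum_add_distrib, Finset.sum_sub_distrib, ← Finset.mul_sum]
  -- Distributing all factors and then extracting them again brings the six sums and the goal to one
  -- common form.
  simp only [Finset.mul_sum] at t1 t2 t3 t4 t5 t6 ⊢
  simp only [← Finset.mul_sum] at t1 t2 t3 t4 t5 t6 ⊢
  rw [t1, t2, t3, t4, t5, t6, hα, hα, hNN]
  ring

namespace IsNormalExtension

variable {Ω S : Set E} {N : E → E}

/-- The tangential part of `x - O`. -/
noncomputable def tangentialPosition (N : E → E) (O x : E) : E := (x - O) - ⟪x - O, N x⟫_ℝ • N x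

theorem continuous_tangentialPosition (h : IsNormalExtension Ω S N) (O : E) :
    Continuous (tangentialPosition N O) := by
  have hN := h.contDiff.continuous
  unfold tangentialPosition
  fun_prop

theorem hasFDerivAt_support (h : IsNormalExtension Ω S N) (O x : E) :
    ∃ A : E →L[ℝ] ℝ, HasFDerivAt (fun x => ⟪x - O, N x⟫_ℝ) A x ∧
      ∀ w, A w = ⟪w, N x⟫_ℝ + ⟪x - O, fderiv ℝ N x w⟫_ℝ := by
  refine ⟨_, ((hasFDerivAt_id x).sub_const O).inner ℝ (h.hasFDerivAt x), fun w => ?_⟩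
  simp [add_comm]

theorem contDiff_support (h : IsNormalExtension Ω S N) (O : E) :
    ContDiff ℝ ∞ fun x => ⟪x - O, N x⟫_ℝ :=
  (contDiff_id.sub contDiff_const).inner ℝ h.contDiff

variable [FiniteDimensional ℝ E]

/-- The mean curvature in terms of an extension of the normal field. -/
noncomputable def extendedMeanCurvature (N : E → E) (x : E) : ℝ :=
  LinearMap.trace ℝ E (fderiv ℝ N x) - ⟪fderiv ℝ N x (N x), N x⟫_ℝ

/-- The defect in the inequality between the volume and the weighted mean curvature integral. -/
noncomputable def defect (N : E → E) (O x : E) : ℝ :=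
  ‖tangentialPosition N O x‖ ^ 2 * extendedMeanCurvature N x +
    ⟪fderiv ℝ N x (tangentialPosition N O x), tangentialPosition N O x⟫_ℝ

theorem tangentialPosition_mem (h : IsNormalExtension Ω S N) (O : E) {p : E} (hp : p ∈ S) :
    tangentialPosition N O p ∈ tangentSpaceAt S p := by
  rw [h.mem_tangentSpaceAt_iff hp, tangentialPosition, inner_sub_right, inner_smul_right,
    real_inner_self_eq_norm_sq, h.norm_eq_one hp, real_inner_comm]
  ring

theorem norm_sq_tangentialPosition (h : IsNormalExtension Ω S N) (O : E) {p : E} (hp : p ∈ S) :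
    ‖p - O‖ ^ 2 = ‖tangentialPosition N O p‖ ^ 2 + ⟪p - O, N p⟫_ℝ ^ 2 := by
  rw [tangentialPosition, norm_sub_sq_real (p - O), inner_smul_right, norm_smul, h.norm_eq_one hp,
    mul_one, Real.norm_eq_abs, sq_abs]
  ring

theorem continuous_extendedMeanCurvature (h : IsNormalExtension Ω S N) :
    Continuous (extendedMeanCurvature N) := by
  have hD : Continuous (fderiv ℝ N) := h.contDiff.continuous_fderiv (by simp)
  have hN := h.contDiff.continuous
  unfold extendedMeanCurvature
  simp only [LinearMap.trace_eq_sum_inner _ (stdOrthonormalBasis ℝ E)]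
  refine (continuous_finsetSum _ fun i _ => ?_).sub ((hD.clm_apply hN).inner hN)
  exact continuous_const.inner (hD.clm_apply continuous_const)

theorem continuous_defect (h : IsNormalExtension Ω S N) (O : E) : Continuous (defect N O) := by
  have hD : Continuous (fderiv ℝ N) := h.contDiff.continuous_fderiv (by simp)
  have hT := h.continuous_tangentialPosition O
  exact ((hT.norm.pow 2).mul h.continuous_extendedMeanCurvature).add ((hD.clm_apply hT).inner hT)

variable [MeasurableSpace E] [BorelSpace E]

/-- Gauss' theorem for the position field x - O, whose divergence is the dimension, one coordinate
at a time. -/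
theorem setIntegral_support_eq (h : IsNormalExtension Ω S N) (O : E) :
    ∫ x in S, ⟪x - O, N x⟫_ℝ ∂μHE[finrank ℝ E - 1] = finrank ℝ E * volume.real Ω := by
  set b := stdOrthonormalBasis ℝ E
  have h1 : ∀ i, ∫ x in S, ⟪x - O, b i⟫_ℝ * ⟪N x, b i⟫_ℝ ∂μHE[finrank ℝ E - 1] =
      volume.real Ω := fun i => by
    have hk : ContDiff ℝ 1 fun x : E => ⟪x - O, b i⟫_ℝ :=
      (contDiff_id.sub contDiff_const).inner ℝ contDiff_const
    rw [← h.setIntegral_fderiv_eq hk]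
    have : ∀ x, fderiv ℝ (fun x : E => ⟪x - O, b i⟫_ℝ) x (b i) = 1 := fun x => by
      have hd : HasFDerivAt (fun x : E => ⟪x - O, b i⟫_ℝ) _ x :=
        ((hasFDerivAt_id x).sub_const O).inner ℝ (hasFDerivAt_const (b i) x)
      rw [hd.fderiv]
      simp
    simp [this]
  have h2 : ∀ x, ⟪x - O, N x⟫_ℝ = ∑ i, ⟪x - O, b i⟫_ℝ * ⟪N x, b i⟫_ℝ := fun x => by
    simpa only [innerSL_apply_apply] using (b.sum_apply_mul_inner (innerSL ℝ (x - O)) (N x)).symm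
  simp only [h2]
  rw [integral_finsetSum _ fun i _ => h.integrableOn (by
    have := h.contDiff.continuous
    fun_prop)]
  simp [h1]

/-- The integrand is minus the divergence on S of uT, where u = ⟪x - O, N⟫ and T is the tangential
position. It is produced by summing the curl-type identities for the functions u ⟪x - O, bᵢ⟫ ⟪N, bⱼ⟫
over an orthonormal basis. -/
theorem setIntegral_sq_support_mul_eq_zero (h : IsNormalExtension Ω S N) (O : E) :
    ∫ x in S, (⟪x - O, N x⟫_ℝ ^ 2 * extendedMeanCurvature N x -
      (finrank ℝ E - 1) * ⟪x - O, N x⟫_ℝ -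
      ⟪fderiv ℝ N x (tangentialPosition N O x), tangentialPosition N O x⟫_ℝ)
        ∂μHE[finrank ℝ E - 1] = 0 := by
  set b := stdOrthonormalBasis ℝ E
  set k : Fin (finrank ℝ E) → Fin (finrank ℝ E) → E → ℝ := fun i j x =>
    ⟪x - O, N x⟫_ℝ * ⟪x - O, b i⟫_ℝ * ⟪N x, b j⟫_ℝ
  have hk : ∀ i j, ContDiff ℝ 2 (k i j) := fun i j =>
    (((h.contDiff_support O).mul ((contDiff_id.sub contDiff_const).inner ℝ contDiff_const)).mul
      (h.contDiff.inner ℝ contDiff_const)).of_le (WithTop.coe_le_coe.2 le_top)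
  have hkd : ∀ i j x w, fderiv ℝ (k i j) x w =
      (⟪w, N x⟫_ℝ + ⟪x - O, fderiv ℝ N x w⟫_ℝ) * ⟪x - O, b i⟫_ℝ * ⟪N x, b j⟫_ℝ +
        ⟪x - O, N x⟫_ℝ * ⟪w, b i⟫_ℝ * ⟪N x, b j⟫_ℝ +
        ⟪x - O, N x⟫_ℝ * ⟪x - O, b i⟫_ℝ * ⟪fderiv ℝ N x w, b j⟫_ℝ := fun i j x w => by
    obtain ⟨A, hA, hAw⟩ := h.hasFDerivAt_support O x
    have := (hA.mul (((hasFDerivAt_id x).sub_const O).inner ℝ (hasFDerivAt_const (b i) x))).mul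
      ((h.hasFDerivAt x).inner ℝ (hasFDerivAt_const (b j) x))
    have h2 : HasFDerivAt (k i j) _ x := this
    rw [h2.fderiv]
    simp [hAw]
    ring
  have hint : ∀ i j, IntegrableOn (fun x => fderiv ℝ (k i j) x (b j) * ⟪N x, b i⟫_ℝ -
      fderiv ℝ (k i j) x (b i) * ⟪N x, b j⟫_ℝ) S μHE[finrank ℝ E - 1] := fun i j => by
    have h1 : Continuous (fderiv ℝ (k i j)) := (hk i j).continuous_fderiv two_ne_zero
    have h2 := h.contDiff.continuous
    exact h.integrableOn (by fun_prop)
  have hsum : ∫ x in S, ∑ i, ∑ j, (fderiv ℝ (k i j) x (b j) * ⟪N x, b i⟫_ℝ -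
      fderiv ℝ (k i j) x (b i) * ⟪N x, b j⟫_ℝ) ∂μHE[finrank ℝ E - 1] = 0 := by
    rw [integral_finsetSum _ fun i _ => integrable_finsetSum _ fun j _ => hint i j]
    refine Finset.sum_eq_zero fun i _ => ?_
    rw [integral_finsetSum _ fun j _ => hint i j]
    exact Finset.sum_eq_zero fun j _ => h.setIntegral_fderiv_mul_inner_sub_eq_zero (hk i j) _ _
  rw [← hsum]
  refine setIntegral_congr_fun h.isCompact.isClosed.measurableSet fun x hx => ?_
  simp only [hkd]
  rw [b.sum_sum_curl_eq (fderiv ℝ N x) (x - O) (h.norm_eq_one hx)]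
  have hT := h.inner_fderiv_normal hx (h.tangentialPosition_mem O hx)
  have htr : LinearMap.trace ℝ E (fderiv ℝ N x) = ∑ j, ⟪fderiv ℝ N x (b j), b j⟫_ℝ := by
    rw [LinearMap.trace_eq_sum_inner _ b]
    exact Finset.sum_congr rfl fun j _ => real_inner_comm _ _
  rw [extendedMeanCurvature, htr, Fintype.card_fin]
  -- After this splitting the two terms u ⟪x - O, D N⟫ cancel. What remains of the derivatives is u²
  -- times the trace corrected by ⟪D N, N⟫, which is the mean curvature, and ⟪D T, T⟫.
  have hX : x - O = tangentialPosition N O x + ⟪x - O, N x⟫_ℝ • N x := by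
    rw [tangentialPosition, sub_add_cancel]
  set T := tangentialPosition N O x
  set u := ⟪x - O, N x⟫_ℝ
  set D := fderiv ℝ N x
  have e1 : D (x - O) = D T + u • D (N x) := by rw [hX, map_add, map_smul]
  have e2 : ⟪x - O, D T⟫_ℝ = ⟪D T, T⟫_ℝ := by
    rw [hX, inner_add_left, inner_smul_left, hT, real_inner_comm]; simp
  have e3 : ⟪D T, N x⟫_ℝ = 0 := by rw [real_inner_comm, hT]
  rw [e1, inner_add_right, inner_smul_right, e2, inner_add_left, inner_smul_left, e3]
  simp
  ring

/-- The integral identity behind the inequality. -/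
theorem setIntegral_norm_sq_mul_eq (h : IsNormalExtension Ω S N) (O : E) :
    ∫ x in S, ‖x - O‖ ^ 2 * extendedMeanCurvature N x ∂μHE[finrank ℝ E - 1] =
      (finrank ℝ E - 1) * (finrank ℝ E * volume.real Ω) +
        ∫ x in S, defect N O x ∂μHE[finrank ℝ E - 1] := by
  have hD : Continuous (fderiv ℝ N) := h.contDiff.continuous_fderiv (by simp)
  have hN := h.contDiff.continuous
  have hT := h.continuous_tangentialPosition O
  have hH := h.continuous_extendedMeanCurvature
  have hu := (h.contDiff_support O).continuous
  have i2 : IntegrableOn (fun x => ((finrank ℝ E : ℝ) - 1) * ⟪x - O, N x⟫_ℝ) S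
        μHE[finrank ℝ E - 1] := h.integrableOn (by fun_prop)
  have i3 : IntegrableOn (defect N O) S μHE[finrank ℝ E - 1] :=
    h.integrableOn (h.continuous_defect O)
  have i4 : IntegrableOn (fun x => ((finrank ℝ E : ℝ) - 1) * ⟪x - O, N x⟫_ℝ + defect N O x) S
      μHE[finrank ℝ E - 1] := i2.add i3
  have key := h.setIntegral_sq_support_mul_eq_zero O
  rw [← h.setIntegral_support_eq O, ← integral_const_mul, ← integral_add i2 i3, ← sub_eq_zero,
    ← integral_sub (h.integrableOn (by fun_prop)) i4, ← key]
  refine setIntegral_congr_fun h.isCompact.isClosed.measurableSet fun x hx => ?_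
  simp only [h.norm_sq_tangentialPosition O hx, defect]
  ring

end IsNormalExtension

end TangentialIdentity

/-! ### Sign of the defect and the equality case -/

section MainInequality

open Module

variable {E : Type*} [NormedAddCommGroup E] [InnerProductSpace ℝ E]

/-- A bounded domain whose boundary lies on a sphere is a ball. -/
theorem IsRegionEnclosedBy.eq_sphere_of_subset [Nontrivial E] {Ω S : Set E}
    (hΩ : IsRegionEnclosedBy Ω S) {O : E} {R : ℝ} (hS : S ⊆ Metric.sphere O R) :
    0 < R ∧ S = Metric.sphere O R := by
  have hcb : Ω ⊆ Metric.closedBall O R := by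
    intro x hx
    by_contra hxR
    rw [Metric.mem_closedBall, dist_eq_norm, not_le] at hxR
    -- The part of the ray from O through x beyond radius R is connected and misses S. It cannot lie
    -- in Ω, being unbounded, nor outside the closure of Ω, since it contains x.
    have hpre : IsPreconnected ((fun s : ℝ => O + s • (x - O)) '' {s | R < s * ‖x - O‖ ∧ 0 < s}) := by
      refine IsPreconnected.image ?_ _ (by fun_prop)
      refine Set.OrdConnected.isPreconnected ⟨fun a ha b _ c hc => ?_⟩
      exact ⟨ha.1.trans_le (mul_le_mul_of_nonneg_right hc.1 (norm_nonneg _)), ha.2.trans_le hc.1⟩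
    have hdis : Disjoint ((fun s : ℝ => O + s • (x - O)) '' {s | R < s * ‖x - O‖ ∧ 0 < s}) S := by
      rw [disjoint_left]
      rintro _ ⟨s, ⟨hs, hs0⟩, rfl⟩ hmem
      have := hS hmem
      rw [mem_sphere_iff_norm, add_sub_cancel_left, norm_smul, Real.norm_of_nonneg hs0.le] at this
      exact hs.ne' this
    have hxm : x ∈ (fun s : ℝ => O + s • (x - O)) '' {s | R < s * ‖x - O‖ ∧ 0 < s} :=
      ⟨1, by simpa using hxR, by simp⟩
    rcases hΩ.subset_or_disjoint_closure hpre hdis with h | h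
    · obtain ⟨C, hC⟩ := hΩ.isBounded.subset_closedBall O
      -- For x = O the radius would be negative and S empty, so Ω would be clopen and therefore the
      -- whole space.
      have hx0 : 0 < ‖x - O‖ := norm_pos_iff.2 fun h0 => by
        have hxO : x = O := sub_eq_zero.1 h0
        have hR : R < 0 := by simpa [h0] using hxR
        have hSe : S = ∅ := by
          rw [Metric.sphere_eq_empty_of_neg hR] at hS
          exact subset_empty_iff.1 hS
        have hcl : IsClopen Ω := isClopen_iff_frontier_eq_empty.2 (hΩ.frontier_eq.trans hSe)
        have huniv := hcl.eq_univ hΩ.isConnected.nonempty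
        exact NormedSpace.unbounded_univ ℝ E (huniv ▸ hΩ.isBounded)
      set s := max 1 ((|C| + 1) / ‖x - O‖) with hs
      have hs1 : 1 ≤ s := le_max_left _ _
      have hmem := hC (h ⟨s, ⟨hxR.trans_le (le_mul_of_one_le_left (norm_nonneg _) hs1),
        by linarith⟩, rfl⟩)
      rw [mem_closedBall_iff_norm, add_sub_cancel_left, norm_smul,
        Real.norm_of_nonneg (by linarith)] at hmem
      have h2 : |C| + 1 ≤ s * ‖x - O‖ := (div_le_iff₀ hx0).1 (le_max_right _ _)
      linarith [le_abs_self C]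
    · exact h hxm (subset_closure hx)
  have hR : 0 < R := by
    by_contra hR
    obtain ⟨x, hx⟩ := hΩ.isConnected.nonempty
    have hsub : Ω ⊆ {O} := fun y hy => by
      have := hcb hy
      rw [Metric.mem_closedBall] at this
      exact dist_le_zero.1 (this.trans (not_lt.1 hR))
    have h1 := hΩ.isOpen.subset_interior_iff.2 hsub
    have : (𝓝[≠] O).NeBot := Module.punctured_nhds_neBot ℝ E O
    rw [interior_singleton] at h1
    exact h1 hx
  refine ⟨hR, ?_⟩
  have hΩb : Ω ⊆ Metric.ball O R := by
    rw [← interior_closedBall O hR.ne']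
    exact interior_maximal hcb hΩ.isOpen
  have hdis : Disjoint (Metric.ball O R) S :=
    disjoint_left.2 fun x hx hxS => (Metric.mem_ball.1 hx).ne (Metric.mem_sphere.1 (hS hxS))
  have hΩeq : Ω = Metric.ball O R := by
    rcases hΩ.subset_or_disjoint_closure (convex_ball O R).isPreconnected hdis with h | h
    · exact hΩb.antisymm h
    · obtain ⟨x, hx⟩ := hΩ.isConnected.nonempty
      exact absurd (subset_closure hx) (h (hΩb hx))
  rw [← hΩ.frontier_eq, hΩeq, frontier_ball O hR.ne']

namespace IsNormalExtension

variable {Ω S : Set E} {N : E → E}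

theorem inner_fderiv_nonneg (h : IsNormalExtension Ω S N) (hconvex : IsConvexHypersurface Ω S)
    {p w : E} (hp : p ∈ S) (hw : w ∈ tangentSpaceAt S p) : 0 ≤ ⟪fderiv ℝ N p w, w⟫_ℝ := by
  have := hconvex p hp ⟨w, hw⟩
  rwa [h.secondFundamentalForm_eq hp] at this

variable [FiniteDimensional ℝ E]

theorem extendedMeanCurvature_nonneg (h : IsNormalExtension Ω S N)
    (hconvex : IsConvexHypersurface Ω S) {p : E} (hp : p ∈ S) : 0 ≤ extendedMeanCurvature N p := by
  rw [extendedMeanCurvature, ← h.meanCurvature_eq hp]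
  exact Finset.sum_nonneg fun i _ => hconvex p hp _

theorem defect_nonneg (h : IsNormalExtension Ω S N) (hconvex : IsConvexHypersurface Ω S) (O : E)
    {p : E} (hp : p ∈ S) : 0 ≤ defect N O p :=
  add_nonneg (mul_nonneg (sq_nonneg _) (h.extendedMeanCurvature_nonneg hconvex hp))
    (h.inner_fderiv_nonneg hconvex hp (h.tangentialPosition_mem O hp))

/-- A null vector of a positive semidefinite second fundamental form lies in its kernel. -/
theorem inner_fderiv_eq_zero (h : IsNormalExtension Ω S N) (hconvex : IsConvexHypersurface Ω S)
    {p v w : E} (hp : p ∈ S) (hv : v ∈ tangentSpaceAt S p) (hw : w ∈ tangentSpaceAt S p)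
    (h0 : ⟪fderiv ℝ N p v, v⟫_ℝ = 0) : ⟪fderiv ℝ N p v, w⟫_ℝ = 0 := by
  have hsymm := h.inner_fderiv_symm hp hv hw
  have hγ := h.inner_fderiv_nonneg hconvex hp hw
  set β := ⟪fderiv ℝ N p v, w⟫_ℝ
  set γ := ⟪fderiv ℝ N p w, w⟫_ℝ
  have hs : ∀ s : ℝ, 0 ≤ 2 * s * β + s ^ 2 * γ := fun s => by
    have h1 := h.inner_fderiv_nonneg hconvex hp
      (Submodule.add_mem _ hv (Submodule.smul_mem _ s hw))
    rw [map_add, map_smul, inner_add_left, inner_add_right, inner_add_right, inner_smul_left,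
      inner_smul_left, inner_smul_right, inner_smul_right, h0, ← hsymm] at h1
    simp only [conj_trivial] at h1
    change 0 ≤ 0 + s * β + (s * β + s * (s * γ)) at h1
    linarith
  -- The minimizer of the quadratic would be -β/γ; the shift by 1 keeps the denominator positive
  -- when γ = 0 and still forces β = 0.
  have h1 := hs (-β / (γ + 1))
  have hγ1 : 0 < γ + 1 := by linarith
  have h2 : 2 * (-β / (γ + 1)) * β + (-β / (γ + 1)) ^ 2 * γ = -(β ^ 2 * (γ + 2)) / (γ + 1) ^ 2 := by
    field_simp
    ring
  rw [h2, le_div_iff₀ (by positivity), zero_mul] at h1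
  have h3 : β ^ 2 * (γ + 2) = 0 := le_antisymm (by linarith) (by positivity)
  rcases mul_eq_zero.1 h3 with h4 | h4
  · exact pow_eq_zero_iff two_ne_zero |>.1 h4
  · linarith

/-- T is, up to the factor 2, the tangential gradient of the squared distance to O, hence zero at a
maximum. -/
theorem tangentialPosition_eq_zero_of_isMaxOn (h : IsNormalExtension Ω S N) {O p : E} (hp : p ∈ S)
    (hmax : IsMaxOn (fun x => ‖x - O‖ ^ 2) S p) : tangentialPosition N O p = 0 := by
  have hd : HasFDerivAt (fun x : E => ‖x - O‖ ^ 2) _ p :=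
    ((hasFDerivAt_id p).sub_const O).norm_sq
  have hT := h.tangentialPosition_mem O hp
  have h1 := h.fderiv_apply_eq_zero_of_isMaxOn hd.differentiableAt hp hmax hT
  rw [hd.fderiv] at h1
  have h2 : ⟪p - O, tangentialPosition N O p⟫_ℝ = 0 := by
    rw [inner_sub_left]; simpa [inner_sub_left] using h1
  have h3 : ⟪N p, tangentialPosition N O p⟫_ℝ = 0 := (h.mem_tangentSpaceAt_iff hp).1 hT
  have h4 : ⟪tangentialPosition N O p, tangentialPosition N O p⟫_ℝ = 0 := by
    nth_rw 1 [tangentialPosition]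
    rw [inner_sub_left, inner_smul_left, h2, h3]; simp
  exact inner_self_eq_zero.1 h4

theorem subset_sphere_of_defect_eq_zero (h : IsNormalExtension Ω S N)
    (hconvex : IsConvexHypersurface Ω S) {O : E} (h0 : ∀ p ∈ S, defect N O p = 0) :
    ∃ R, S ⊆ Metric.sphere O R := by
  have hII : ∀ p ∈ S, ⟪fderiv ℝ N p (tangentialPosition N O p), tangentialPosition N O p⟫_ℝ = 0 := by
    intro p hp
    have h1 := h0 p hp
    have h2 := h.inner_fderiv_nonneg hconvex hp (h.tangentialPosition_mem O hp)
    have h3 := mul_nonneg (sq_nonneg ‖tangentialPosition N O p‖)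
      (h.extendedMeanCurvature_nonneg hconvex hp)
    rw [defect] at h1
    linarith
  -- The derivative of u = ⟪x - O, N⟫ along a tangent vector w is II(w, T), and a null vector T of a
  -- semidefinite form lies in its kernel.
  have hconst : ∀ p ∈ S, ∀ q ∈ S, ⟪p - O, N p⟫_ℝ = ⟪q - O, N q⟫_ℝ := by
    intro p hp q hq
    refine h.eq_of_fderiv_apply_eq_zero (φ := fun x => ⟪x - O, N x⟫_ℝ)
      ((h.contDiff_support O).differentiable (by simp)) (fun x hx w hw => ?_) hp hq
    obtain ⟨A, hA, hAw⟩ := h.hasFDerivAt_support O x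
    have hT := h.tangentialPosition_mem O hx
    have hX : x - O = tangentialPosition N O x + ⟪x - O, N x⟫_ℝ • N x := by
      rw [tangentialPosition, sub_add_cancel]
    rw [hA.fderiv, hAw, real_inner_comm, (h.mem_tangentSpaceAt_iff hx).1 hw, zero_add]
    generalize ⟪x - O, N x⟫_ℝ = u at hX
    rw [hX, inner_add_left, inner_smul_left, h.inner_fderiv_normal hx hw, real_inner_comm,
      h.inner_fderiv_symm hx hw hT, h.inner_fderiv_eq_zero hconvex hx hT hw (hII x hx)]
    simp
  -- At the farthest point q the squared distance equals the constant u², which is a lower bound for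
  -- the squared distance at every other point.
  obtain ⟨q, hq, hmax⟩ := h.isCompact.exists_isMaxOn h.isConnected.nonempty
    (f := fun x => ‖x - O‖ ^ 2) (by fun_prop)
  refine ⟨‖q - O‖, fun x hx => ?_⟩
  have h1 := h.norm_sq_tangentialPosition O hq
  have h2 := h.norm_sq_tangentialPosition O hx
  rw [h.tangentialPosition_eq_zero_of_isMaxOn hq hmax, norm_zero, hconst q hq x hx] at h1
  have h3 : ‖x - O‖ ^ 2 ≤ ‖q - O‖ ^ 2 := hmax hx
  rw [mem_sphere_iff_norm]
  refine (sq_eq_sq₀ (norm_nonneg _) (norm_nonneg _)).1 (le_antisymm h3 ?_)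
  nlinarith [sq_nonneg ‖tangentialPosition N O x‖]

theorem defect_eq_zero_of_sphere (h : IsNormalExtension Ω S N) {O : E} {R : ℝ}
    (hS : S = Metric.sphere O R) {p : E} (hp : p ∈ S) : defect N O p = 0 := by
  have hmax : IsMaxOn (fun x => ‖x - O‖ ^ 2) S p := fun x hx => by
    have h1 : ‖x - O‖ = R := mem_sphere_iff_norm.1 (hS ▸ hx)
    have h2 : ‖p - O‖ = R := mem_sphere_iff_norm.1 (hS ▸ hp)
    simp only [mem_ofPred_eq, h1, h2, le_refl]
  rw [defect, h.tangentialPosition_eq_zero_of_isMaxOn hp hmax]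
  simp

variable [MeasurableSpace E] [BorelSpace E]

/-- A nonzero value would persist by continuity on a relatively open piece of S, which has positive
area, while a nonnegative function with zero integral vanishes almost everywhere. -/
theorem defect_eq_zero_of_setIntegral_eq_zero (h : IsNormalExtension Ω S N)
    (hconvex : IsConvexHypersurface Ω S) {O : E}
    (h0 : ∫ x in S, defect N O x ∂μHE[finrank ℝ E - 1] = 0) {p : E} (hp : p ∈ S) :
    defect N O p = 0 := by
  by_contra hne
  have hSm := h.isCompact.isClosed.measurableSet
  have hae := (setIntegral_eq_zero_iff_of_nonneg_ae ((ae_restrict_mem hSm).mono fun x hx =>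
    h.defect_nonneg hconvex O hx) (h.integrableOn (h.continuous_defect O))).1 h0
  have hpos := h.measure_inter_pos hp
    ((isOpen_ne_fun (h.continuous_defect O) continuous_const).mem_nhds hne)
  rw [Filter.EventuallyEq, ae_restrict_iff' hSm, ae_iff] at hae
  refine hpos.ne' (measure_mono_null (fun x hx => ?_) hae)
  simp only [mem_ofPred_eq, Classical.not_imp]
  exact ⟨hx.1, hx.2⟩

end IsNormalExtension

end MainInequality

/-! ### The inequality and its equality case -/

theorem mainTheorem3 (n : ℕ) (hn : 2 ≤ n) (S Ω : Set (EuclideanSpace ℝ (Fin n)))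
    (O : EuclideanSpace ℝ (Fin n))
    (hS : IsSmoothHypersurface S) (hcompact : IsCompact S) (hconn : IsConnected S)
    (hΩ : IsRegionEnclosedBy Ω S) (hconvex : IsConvexHypersurface Ω S) :
    (n : ℝ) * volume.real Ω ≤
        1 / ((n : ℝ) - 1) * ∫ x in S, dist x O ^ 2 * meanCurvature Ω S x ∂μHE[n - 1] ∧
      ((n : ℝ) * volume.real Ω =
          1 / ((n : ℝ) - 1) * ∫ x in S, dist x O ^ 2 * meanCurvature Ω S x ∂μHE[n - 1] ↔
        ∃ R : ℝ, 0 < R ∧ S = Metric.sphere O R) := by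
  have hfin : Module.finrank ℝ (EuclideanSpace ℝ (Fin n)) = n := finrank_euclideanSpace_fin
  have : Nontrivial (EuclideanSpace ℝ (Fin n)) :=
    Module.nontrivial_of_finrank_pos (R := ℝ) (by omega)
  obtain ⟨N, hN⟩ := hΩ.exists_isNormalExtension hS hcompact hconn
  have hSm := hcompact.isClosed.measurableSet
  have hn1 : (0 : ℝ) < n - 1 := by
    have : (2 : ℝ) ≤ n := by exact_mod_cast hn
    linarith
  have hint : ∫ x in S, dist x O ^ 2 * meanCurvature Ω S x ∂μHE[n - 1] =
      (n - 1) * (n * volume.real Ω) +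
        ∫ x in S, IsNormalExtension.defect N O x ∂μHE[n - 1] := by
    have h1 := hN.setIntegral_norm_sq_mul_eq O
    rw [hfin] at h1
    rw [← h1]
    refine setIntegral_congr_fun hSm fun x hx => ?_
    simp only [dist_eq_norm, hN.meanCurvature_eq hx, IsNormalExtension.extendedMeanCurvature]
  have hnonneg : 0 ≤ ∫ x in S, IsNormalExtension.defect N O x ∂μHE[n - 1] :=
    setIntegral_nonneg hSm fun x hx => hN.defect_nonneg hconvex O hx
  rw [hint]
  -- Both claims now concern only the integral of the defect: its sign gives the inequality, its
  -- vanishing the equality case.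
  have hdiv : 1 / ((n : ℝ) - 1) * ((n - 1) * (n * volume.real Ω) +
      ∫ x in S, IsNormalExtension.defect N O x ∂μHE[n - 1]) = n * volume.real Ω +
        1 / ((n : ℝ) - 1) * ∫ x in S, IsNormalExtension.defect N O x ∂μHE[n - 1] := by
    field_simp
  rw [hdiv]
  refine ⟨le_add_of_nonneg_right (by positivity), fun heq => ?_, ?_⟩
  · have h0 : ∫ x in S, IsNormalExtension.defect N O x ∂μHE[n - 1] = 0 := by
      have h2 := left_eq_add.1 heq
      exact (mul_eq_zero.1 h2).resolve_left (by positivity)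
    obtain ⟨R, hR⟩ := hN.subset_sphere_of_defect_eq_zero hconvex fun p hp =>
      hN.defect_eq_zero_of_setIntegral_eq_zero hconvex (by rw [hfin]; exact h0) hp
    exact ⟨R, hΩ.eq_sphere_of_subset hR⟩
  · rintro ⟨R, -, hR⟩
    rw [setIntegral_congr_fun hSm fun x hx => hN.defect_eq_zero_of_sphere hR hx]
    simp
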